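/- Let $m,n,p$ be positive integers with $p\le\min\{m,n\}$, let $\mathcal M_p=\{X\in\mathbb R^{m\times n}:\operatorname{rank}X=p\}$ (an embedded submanifold of $\mathbb R^{m\times n}$), let $f:\mathcal M_p\to\mathbb R$ be smooth, and let $\|\cdot\|$ be the Frobenius norm. A point $X_*\in\mathcal M_p$ is a nondegenerate critical point of $f$ if $\operatorname{grad}f(X_*)=0$ and the Hessian $\mathrm T_{X_*}\mathcal M_p\ni\xi\mapsto\nabla_\xi\operatorname{grad}f\in\mathrm T_{X_*}\mathcal M_p$ is invertible, where $\operatorname{grad}$ and $\nabla$ are the gradient and the Levi-Civita connection of a Riemannian metric on $\mathcal M_p$; this notion does not depend on the metric, and the result below holds whichever Riemannian metric is used in it. Write $\pi(M,N)=MN^{\mathsf T}$, $\bar f=f\circ\pi$, $\operatorname{sym}(Z)=\frac12(Z+Z^{\mathsf T})$, let $\partial_M\bar f,\partial_N\bar f$ be the Euclidean partial gradients of $\bar f$, and let $\partial_u Y$ be the Euclidean derivative of a field $Y=(Y_M,Y_N)$ along $u=(u_M,u_N)$. Let $\mathbb R_*^{a\times p}$ be the set of full-rank $a\times p$ matrices.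 Consider two Newton iterations on $\mathcal M_p$. (A) On $T=\mathbb R_*^{m\times p}\times\mathbb R_*^{n\times p}$ take the metric $\bar g_{(M,N)}(u,v)=\operatorname{tr}\big((M^{\mathsf T}M)^{-1}u_M^{\mathsf T}v_M+(N^{\mathsf T}N)^{-1}u_N^{\mathsf T}v_N\big)$, the vertical space $\mathcal V_{(M,N)}=\{(MR,-NR^{\mathsf T}):R\in\mathbb R^{p\times p}\}$, its $\bar g$-orthogonal complement $\mathcal H_{(M,N)}$, the gradient $\operatorname{grad}\bar f=(\partial_M\bar f\,M^{\mathsf T}M,\ \partial_N\bar f\,N^{\mathsf T}N)$, the Riemannian connection $\bar\nabla$ of $\bar g$, $$(\bar\nabla_uY)_M=\partial_uY_M-Y_M(M^{\mathsf T}M)^{-1}\operatorname{sym}(u_M^{\mathsf T}M)-u_M(M^{\mathsf T}M)^{-1}\operatorname{sym}(Y_M^{\mathsf T}M)+M(M^{\mathsf T}M)^{-1}\operatorname{sym}(u_M^{\mathsf T}Y_M)$$ and likewise for the $N$-component, and the update $\rho_{(M,N)}(u)=(M+u_M)(N+u_N)^{\mathsf T}$. (B) On $T=\{M\in\mathbb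 R^{m\times p}:M^{\mathsf T}M=I_p\}\times\mathbb R_*^{n\times p}$ take the Euclidean metric, the tangent space $\mathrm T_{(M,N)}T=\{u:M^{\mathsf T}u_M+u_M^{\mathsf T}M=0\}$, the vertical space $\mathcal V_{(M,N)}=\{(M\Omega,N\Omega):\Omega=-\Omega^{\mathsf T}\}$, its orthogonal complement $\mathcal H_{(M,N)}$ in $\mathrm T_{(M,N)}T$, the orthogonal projection $P_{(M,N)}(w_M,w_N)=(w_M-M\operatorname{sym}(M^{\mathsf T}w_M),w_N)$ onto the tangent space, $\operatorname{grad}\bar f=P(\partial_M\bar f,\partial_N\bar f)$, $\bar\nabla_uY=P\,\partial_uY$, and the update $\rho_{(M,N)}(u)=\pi(\operatorname{Exp}_{(M,N)}(u))$, where, with $A=M^{\mathsf T}u_M$ and $S=u_M^{\mathsf T}u_M$, $$\operatorname{Exp}_{(M,N)}(u)=\Big(\begin{bmatrix}M&u_M\end{bmatrix}\exp\begin{bmatrix}A&-S\\ I&A\end{bmatrix}\begin{bmatrix}I_p\\0\end{bmatrix}\exp(-A),\ N+u_N\Big).$$ In both cases let $P^{\mathrm h}_{(M,N)}$ be the projection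 onto $\mathcal H_{(M,N)}$ along $\mathcal V_{(M,N)}$. The iteration maps $X=MN^{\mathsf T}$, $(M,N)\in T$, to $\rho_{(M,N)}(u)$, where $u\in\mathcal H_{(M,N)}$ is the solution of the Newton equation $$P^{\mathrm h}_{(M,N)}\big(\bar\nabla_u\operatorname{grad}\bar f\big)=-\operatorname{grad}\bar f(M,N).$$ It is well defined at $X$ if this solution exists and is unique for every factorization $X=MN^{\mathsf T}$ with $(M,N)\in T$, and the result lies in $\mathcal M_p$ and does not depend on the factorization. Theorem (quadratic convergence). Let $X_*$ be a nondegenerate critical point of $f$. For each of the iterations (A) and (B) there are a neighborhood $\mathcal U$ of $X_*$ in $\mathcal M_p$ and a constant $C$ such that, for every $X_0\in\mathcal U$, the iteration is well defined at every step and generates an infinite sequence $(X_k)_{k\ge0}$ in $\mathcal M_p$ that converges to $X_*$ superlinearly, $\|X_{k+1}-X_*\|=o(\|X_k-X_*\|)$, and at least quadratically, $\|X_{k+1}-X_*\|\le C\|X_k-X_*\|^2$ for all $k\ge0$. -/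

import Mathlib

open Filter Topology Asymptotics
open scoped Matrix ContDiff

attribute [local instance] Matrix.frobeniusNormedAddCommGroup Matrix.frobeniusNormedSpace

noncomputable section

namespace FixedRank

/-- Real `a × b` matrices. They carry the Frobenius norm throughout. -/
abbrev Mat (a b : ℕ) := Matrix (Fin a) (Fin b) ℝ

/-- The linear space of pairs `(M, N)`. -/
abbrev Pair (m n p : ℕ) := Mat m p × Mat n p

/-- The set of rank-`p` matrices of size `m × n`. -/
def Mp (m n p : ℕ) : Set (Mat m n) := {X | X.rank = p}

/-- The pairs `(M, N)` of full-rank factors. -/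
def Rp (m n p : ℕ) : Set (Pair m n p) := {z | z.1.rank = p ∧ z.2.rank = p}

/-- The pairs `(M, N)` with `M` orthonormal and `N` of full rank. -/
def SRp (m n p : ℕ) : Set (Pair m n p) := {z | z.1ᵀ * z.1 = 1 ∧ z.2.rank = p}

variable {m n p : ℕ}

/-- The map `(M, N) ↦ M Nᵀ`. -/
def proj (z : Pair m n p) : Mat m n := z.1 * z.2ᵀ

/-- Symmetric part of a square matrix. -/
def symPart (Z : Mat p p) : Mat p p := (1 / 2 : ℝ) • (Z + Zᵀ)

/-! ### Differential geometry of the submanifold of rank-`p` matrices -/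

/-- `φ` is smooth as a map on the embedded submanifold `Mp m n p`: locally it is the restriction
of a smooth map defined on an open subset of the ambient space. Values of `φ` outside the
submanifold are irrelevant. -/
def SmoothOnMp {F : Type*} [NormedAddCommGroup F] [NormedSpace ℝ F] (p : ℕ)
    (φ : Mat m n → F) : Prop :=
  ∀ X ∈ Mp m n p, ∃ V : Set (Mat m n), IsOpen V ∧ X ∈ V ∧
    ∃ Φ : Mat m n → F, ContDiffOn ℝ ∞ Φ V ∧ ∀ Y ∈ V ∩ Mp m n p, Φ Y = φ Y

/-- The differential at `X` of a map on the submanifold `Mp m n p`. Only its values on vectors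
tangent at `X ∈ Mp m n p` are meaningful (and these are uniquely determined). -/
def diffMp {F : Type*} [NormedAddCommGroup F] [NormedSpace ℝ F] (p : ℕ)
    (φ : Mat m n → F) (X : Mat m n) : Mat m n →L[ℝ] F :=
  fderivWithin ℝ φ (Mp m n p) X

/-- The tangent space of `Mp m n p` at `X ∈ Mp m n p`, i.e. the set of all `A X + X B`. By
`mem_tangentSpace_proj` below it is the image of the differential of the submersion `(M, N) ↦ M Nᵀ`
at any point of the fibre over `X`. -/
def tangentSpace (X : Mat m n) : Submodule ℝ (Mat m n) where
  carrier := {ξ | ∃ (A : Mat m m) (B : Mat n n), ξ = A * X + X * B}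
  zero_mem' := ⟨0, 0, by simp⟩
  add_mem' := by
    rintro _ _ ⟨A, B, rfl⟩ ⟨A', B', rfl⟩
    exact ⟨A + A', B + B', by rw [Matrix.add_mul, Matrix.mul_add]; abel⟩
  smul_mem' := by
    rintro c _ ⟨A, B, rfl⟩
    exact ⟨c • A, c • B, by simp⟩

theorem isUnit_gram {a b : ℕ} {M : Mat a b} (h : M.rank = b) : IsUnit (Mᵀ * M).det := by
  rw [← Matrix.isUnit_iff_isUnit_det, ← Matrix.mulVec_injective_iff_isUnit]
  have hr : (Mᵀ * M).rank = b := by rw [Matrix.rank_transpose_mul_self, h]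
  have hk := (Mᵀ * M).mulVecLin.finrank_range_add_finrank_ker
  rw [Matrix.rank] at hr
  have h0 : Module.finrank ℝ (LinearMap.ker (Mᵀ * M).mulVecLin) = 0 := by
    rw [hr] at hk; simpa using hk
  exact LinearMap.ker_eq_bot.1 (Submodule.finrank_eq_zero.1 h0)

theorem mem_tangentSpace_proj {z : Pair m n p} (hz : z ∈ Rp m n p) (ξ : Mat m n) :
    ξ ∈ tangentSpace (proj z) ↔ ∃ w : Pair m n p, ξ = w.1 * z.2ᵀ + z.1 * w.2ᵀ := by
  constructor
  · rintro ⟨A, B, rfl⟩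
    exact ⟨(A * z.1, Bᵀ * z.2), by simp [proj, Matrix.mul_assoc, Matrix.transpose_mul]⟩
  · rintro ⟨w, rfl⟩
    refine ⟨w.1 * (z.1ᵀ * z.1)⁻¹ * z.1ᵀ, z.2 * (z.2ᵀ * z.2)⁻¹ * w.2ᵀ, ?_⟩
    have h1 := Matrix.nonsing_inv_mul _ (isUnit_gram hz.1)
    have h2 := Matrix.mul_nonsing_inv _ (isUnit_gram hz.2)
    have e1 : w.1 * (z.1ᵀ * z.1)⁻¹ * z.1ᵀ * proj z
        = w.1 * ((z.1ᵀ * z.1)⁻¹ * (z.1ᵀ * z.1)) * z.2ᵀ := by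
      simp only [proj, Matrix.mul_assoc]
    have e2 : proj z * (z.2 * (z.2ᵀ * z.2)⁻¹ * w.2ᵀ)
        = z.1 * ((z.2ᵀ * z.2) * (z.2ᵀ * z.2)⁻¹) * w.2ᵀ := by
      simp only [proj, Matrix.mul_assoc]
    rw [e1, e2, h1, h2, Matrix.mul_one, Matrix.mul_one]

/-- Smooth vector fields on `Mp m n p`. -/
def IsVectorField (p : ℕ) (η : Mat m n → Mat m n) : Prop :=
  SmoothOnMp p η ∧ ∀ X ∈ Mp m n p, η X ∈ tangentSpace X

/-- `g` is a (smooth) Riemannian metric on `Mp m n p`. -/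
structure IsRiemannianMetric (p : ℕ) (g : Mat m n → Mat m n → Mat m n → ℝ) : Prop where
  add_left : ∀ X ∈ Mp m n p, ∀ ξ ∈ tangentSpace X, ∀ η ∈ tangentSpace X, ∀ ζ ∈ tangentSpace X,
    g X (ξ + η) ζ = g X ξ ζ + g X η ζ
  smul_left : ∀ X ∈ Mp m n p, ∀ c : ℝ, ∀ ξ ∈ tangentSpace X, ∀ ζ ∈ tangentSpace X,
    g X (c • ξ) ζ = c * g X ξ ζ
  symm : ∀ X ∈ Mp m n p, ∀ ξ ∈ tangentSpace X, ∀ ζ ∈ tangentSpace X, g X ξ ζ = g X ζ ξ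
  pos : ∀ X ∈ Mp m n p, ∀ ξ ∈ tangentSpace X, ξ ≠ 0 → 0 < g X ξ ξ
  smooth : ∀ η ζ, IsVectorField p η → IsVectorField p ζ → SmoothOnMp p fun X => g X (η X) (ζ X)

/-- `del χ η`, read `∇_χ η`, is the Riemannian (Levi-Civita) connection of the metric `g` on
`Mp m n p`: the affine connection that is torsion-free and compatible with the metric. -/
structure IsLeviCivita (p : ℕ) (g : Mat m n → Mat m n → Mat m n → ℝ)
    (del : (Mat m n → Mat m n) → (Mat m n → Mat m n) → Mat m n → Mat m n) : Prop where
  isVectorField : ∀ χ η, IsVectorField p χ → IsVectorField p η → IsVectorField p (del χ η)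
  add_left : ∀ χ χ' η, IsVectorField p χ → IsVectorField p χ' → IsVectorField p η →
    ∀ X ∈ Mp m n p, del (fun Y => χ Y + χ' Y) η X = del χ η X + del χ' η X
  smul_left : ∀ (φ : Mat m n → ℝ) χ η, SmoothOnMp p φ → IsVectorField p χ → IsVectorField p η →
    ∀ X ∈ Mp m n p, del (fun Y => φ Y • χ Y) η X = φ X • del χ η X
  add_right : ∀ χ η η', IsVectorField p χ → IsVectorField p η → IsVectorField p η' →
    ∀ X ∈ Mp m n p, del χ (fun Y => η Y + η' Y) X = del χ η X + del χ η' X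
  leibniz : ∀ (φ : Mat m n → ℝ) χ η, SmoothOnMp p φ → IsVectorField p χ → IsVectorField p η →
    ∀ X ∈ Mp m n p,
      del χ (fun Y => φ Y • η Y) X = diffMp p φ X (χ X) • η X + φ X • del χ η X
  torsion_free : ∀ χ η, IsVectorField p χ → IsVectorField p η → ∀ X ∈ Mp m n p,
    del χ η X - del η χ X = VectorField.lieBracketWithin ℝ χ η (Mp m n p) X
  metric_compatible : ∀ χ η ζ, IsVectorField p χ → IsVectorField p η → IsVectorField p ζ →
    ∀ X ∈ Mp m n p, diffMp p (fun Y => g Y (η Y) (ζ Y)) X (χ X)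
      = g X (del χ η X) (ζ X) + g X (η X) (del χ ζ X)

/-- `G` is the Riemannian gradient field of `f` on `Mp m n p` for the metric `g`. -/
def IsGradient (p : ℕ) (g : Mat m n → Mat m n → Mat m n → ℝ) (f : Mat m n → ℝ)
    (G : Mat m n → Mat m n) : Prop :=
  IsVectorField p G ∧
    ∀ X ∈ Mp m n p, ∀ ξ ∈ tangentSpace X, g X (G X) ξ = diffMp p f X ξ

/-- `X` is a nondegenerate critical point of `f` on `Mp m n p`: the gradient vanishes at `X`, and
the Hessian `ξ ↦ ∇_ξ grad f` is an invertible linear map of the tangent space at `X`; here `grad`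
and `∇` are the gradient and the Levi-Civita connection of the metric `g`. -/
def IsNondegenerateCriticalPoint (p : ℕ) (g : Mat m n → Mat m n → Mat m n → ℝ)
    (f : Mat m n → ℝ) (X : Mat m n) : Prop :=
  X ∈ Mp m n p ∧ ∃ G del, IsGradient p g f G ∧ IsLeviCivita p g del ∧ G X = 0 ∧
    ∃ hess : tangentSpace X ≃ₗ[ℝ] tangentSpace X,
      ∀ (ξ : tangentSpace X) (χ : Mat m n → Mat m n), IsVectorField p χ → χ X = ξ →
        del χ G X = hess ξ

/-! ### The lifted Newton iterations -/

/-- The function `f` lifted to pairs of factors, `(M, N) ↦ f (M Nᵀ)`. -/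
def lifted (f : Mat m n → ℝ) (z : Pair m n p) : ℝ := f (proj z)

/-- Euclidean gradient of a function of `(M, N)` with respect to `M`. -/
def partialM (F : Pair m n p → ℝ) (z : Pair m n p) : Mat m p :=
  Matrix.of fun i j => fderiv ℝ F z (Matrix.single i j 1, 0)

/-- Euclidean gradient of a function of `(M, N)` with respect to `N`. -/
def partialN (F : Pair m n p → ℝ) (z : Pair m n p) : Mat n p :=
  Matrix.of fun i j => fderiv ℝ F z (0, Matrix.single i j 1)

/-- `h` is the projection of `w` onto the horizontal space `H` along the vertical space `V`. -/
def IsHorizontalProj (H V : Set (Pair m n p)) (w h : Pair m n p) : Prop := h ∈ H ∧ w - h ∈ V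

/-- `u` is a solution in the horizontal space of the lifted Newton equation
`P^h (∇_u Y) = - Y(z)` at `z`, where `Y` is the gradient field on the total space and `conn Y z u`
is `∇_u Y` at `z`. -/
def IsNewtonVector (H V : Pair m n p → Set (Pair m n p))
    (conn : (Pair m n p → Pair m n p) → Pair m n p → Pair m n p → Pair m n p)
    (Y : Pair m n p → Pair m n p) (z u : Pair m n p) : Prop :=
  u ∈ H z ∧ IsHorizontalProj (H z) (V z) (conn Y z u) (-Y z)

/-- `X' ∈ Mp m n p` is the iterate that follows `X`: over `X` there are factorizations in the total
space `T`, and for each of them, `z`, the Newton equation has exactly one solution `u`, whose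
retraction at `z` is `X'`. -/
def IsStep (T : Set (Pair m n p)) (newton : Pair m n p → Pair m n p → Prop)
    (retr : Pair m n p → Pair m n p → Mat m n) (X X' : Mat m n) : Prop :=
  (∃ z ∈ T, proj z = X) ∧ X' ∈ Mp m n p ∧
    ∀ z ∈ T, proj z = X →
      ∃ u, newton z u ∧ (∀ u', newton z u' → u' = u) ∧ retr z u = X'

/-! #### Full-rank factors -/

/-- The metric `tr ((MᵀM)⁻¹ Ṁᵀ M' + (NᵀN)⁻¹ Ṅᵀ N')` on the total space `Rp m n p`. -/
def metric (z u v : Pair m n p) : ℝ :=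
  ((z.1ᵀ * z.1)⁻¹ * u.1ᵀ * v.1 + (z.2ᵀ * z.2)⁻¹ * u.2ᵀ * v.2).trace

/-- The tangent space of the fibre through `z`. -/
def vertical (z : Pair m n p) : Set (Pair m n p) :=
  {v | ∃ R : Mat p p, v = (z.1 * R, -(z.2 * Rᵀ))}

/-- The orthogonal complement of the vertical space. -/
def horizontal (z : Pair m n p) : Set (Pair m n p) := {u | ∀ v ∈ vertical z, metric z u v = 0}

/-- One component (`M` or `N`) of the Riemannian connection of `metric`: `M` is the base point,
`x` the direction, `y` the value of the field and `dy` its Euclidean derivative along `x`. -/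
def connFactor {a : ℕ} (M x y dy : Mat a p) : Mat a p :=
  dy - y * (Mᵀ * M)⁻¹ * symPart (xᵀ * M) - x * (Mᵀ * M)⁻¹ * symPart (yᵀ * M)
    + M * (Mᵀ * M)⁻¹ * symPart (xᵀ * y)

/-- The Riemannian connection of `metric` on `Rp m n p`: `conn Y z u` is `∇_u Y` at `z`. -/
def conn (Y : Pair m n p → Pair m n p) (z u : Pair m n p) : Pair m n p :=
  (connFactor z.1 u.1 (Y z).1 (fderiv ℝ Y z u).1, connFactor z.2 u.2 (Y z).2 (fderiv ℝ Y z u).2)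

/-- The gradient, for `metric`, of the lifted function. -/
def gradLifted (f : Mat m n → ℝ) (z : Pair m n p) : Pair m n p :=
  (partialM (lifted f) z * (z.1ᵀ * z.1), partialN (lifted f) z * (z.2ᵀ * z.2))

/-- Newton iteration `M Nᵀ ↦ (M + Ṁ)(N + Ṅ)ᵀ`, where `(Ṁ, Ṅ)` solves the lifted Newton equation on
`Rp m n p`. -/
def NewtonStep (p : ℕ) (f : Mat m n → ℝ) : Mat m n → Mat m n → Prop :=
  IsStep (Rp m n p) (IsNewtonVector horizontal vertical conn (gradLifted f))
    fun z u => proj (z + u)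

/-! #### First factor orthonormal -/

/-- The tangent space of `SRp m n p` at `z`. -/
def oTangent (z : Pair m n p) : Set (Pair m n p) := {u | z.1ᵀ * u.1 + u.1ᵀ * z.1 = 0}

/-- The Euclidean metric. -/
def oMetric (u v : Pair m n p) : ℝ := (u.1ᵀ * v.1 + u.2ᵀ * v.2).trace

/-- The tangent space of the fibre through `z`. -/
def oVertical (z : Pair m n p) : Set (Pair m n p) :=
  {v | ∃ W : Mat p p, W = -Wᵀ ∧ v = (z.1 * W, z.2 * W)}

/-- The orthogonal complement of the vertical space in the tangent space. -/
def oHorizontal (z : Pair m n p) : Set (Pair m n p) :=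
  {u | u ∈ oTangent z ∧ ∀ v ∈ oVertical z, oMetric u v = 0}

/-- The orthogonal projection onto the tangent space of `SRp m n p` at `z`. -/
def oTangentProj (z w : Pair m n p) : Pair m n p := (w.1 - z.1 * symPart (z.1ᵀ * w.1), w.2)

/-- The Riemannian connection of the Riemannian submanifold `SRp m n p` of the Euclidean space of
pairs; the field `Y` is given on a neighbourhood of `SRp m n p`, on which the result does not
depend. -/
def oConn (Y : Pair m n p → Pair m n p) (z u : Pair m n p) : Pair m n p :=
  oTangentProj z (fderiv ℝ Y z u)

/-- The gradient on `SRp m n p` of the lifted function: the projection of its Euclidean gradient.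
(The formula makes sense on all of `Rp m n p`.) -/
def oGradLifted (f : Mat m n → ℝ) (z : Pair m n p) : Pair m n p :=
  oTangentProj z (partialM (lifted f) z, partialN (lifted f) z)

/-- The Riemannian exponential of `SRp m n p`; the block row `[M Ṁ]` is multiplied by the matrix
exponential of `[A -S; I A]`, by the first `p` columns of the identity of size `2p`, and by the
matrix exponential of `-A`, with `A = MᵀṀ` and `S = ṀᵀṀ`. -/
def oExp (z u : Pair m n p) : Pair m n p :=
  (Matrix.fromCols z.1 u.1
      * NormedSpace.exp
          (Matrix.fromBlocks (z.1ᵀ * u.1) (-(u.1ᵀ * u.1)) (1 : Mat p p) (z.1ᵀ * u.1))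
      * Matrix.fromRows (1 : Mat p p) (0 : Mat p p)
      * NormedSpace.exp (-(z.1ᵀ * u.1)),
    z.2 + u.2)

/-- Newton iteration `M Nᵀ ↦ π (Exp_{(M,N)} (Ṁ, Ṅ))`, where `(Ṁ, Ṅ)` solves the lifted Newton
equation on `SRp m n p`. -/
def NewtonStepOrtho (p : ℕ) (f : Mat m n → ℝ) : Mat m n → Mat m n → Prop :=
  IsStep (SRp m n p) (IsNewtonVector oHorizontal oVertical oConn (oGradLifted f))
    fun z u => proj (oExp z u)

/-! ### Local quadratic convergence -/

/-- From every point of some neighbourhood of `Xs` in `Mp m n p` the iteration `step` generates an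
infinite sequence in `Mp m n p` that converges to `Xs` superlinearly and at least quadratically. -/
def LocallyQuadraticallyConvergent (p : ℕ) (step : Mat m n → Mat m n → Prop) (Xs : Mat m n) :
    Prop :=
  ∃ U ⊆ Mp m n p, U ∈ 𝓝[Mp m n p] Xs ∧ ∃ C : ℝ, ∀ X₀ ∈ U, ∃ X : ℕ → Mat m n,
    X 0 = X₀ ∧ (∀ k, X k ∈ Mp m n p) ∧ (∀ k, step (X k) (X (k + 1))) ∧
    Tendsto X atTop (𝓝 Xs) ∧
    (fun k => X (k + 1) - Xs) =o[atTop] (fun k => X k - Xs) ∧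
    ∀ k, ‖X (k + 1) - Xs‖ ≤ C * ‖X k - Xs‖ ^ 2

end FixedRank

end

/-!
At `z = (M, N)` the lifted Newton equation, together with the condition that the solution be
horizontal and a vertical correction as a second unknown, is a square bordered linear system. Over a
nondegenerate critical point `X` it is nonsingular: there the derivative of the gradient field is
the second derivative of the lifted function, whose kernel is the vertical space. Hence near such a
`z` the Newton vector is a smooth field `x` with `x z = 0`, and differentiating the equation at `z`
gives `dπ ∘ dx = -dπ`. As the retraction `e` agrees with addition to first order,
`w ↦ π (e w (x w))` has zero derivative at `z`, so that `π (e w (x w)) - X` is of the order of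
`‖w - z‖ ^ 2`. A Lipschitz local section of `π` transports this bound to the manifold of rank-`p`
matrices. The factorizations of one matrix form an orbit of the general linear group, or of the
orthogonal group if `M` is kept orthonormal, and the Newton equation and the retraction are
invariant under it; so neither the solvability of the equation nor the iterate depends on the
factorization.
-/

namespace FixedRank

/-! ### Newton fields and quadratic convergence -/

section Analysis

variable {E F K : Type*} [NormedAddCommGroup E] [NormedSpace ℝ E]
  [NormedAddCommGroup F] [NormedSpace ℝ F] [NormedAddCommGroup K] [NormedSpace ℝ K]

theorem isBigO_sub_sq_of_fderiv_eq_zero {f : E → F} {z : E} (hf : ContDiffAt ℝ 2 f z)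
    (h0 : fderiv ℝ f z = 0) : (fun w => f w - f z) =O[𝓝 z] fun w => ‖w - z‖ ^ 2 := by
  obtain ⟨K, t, ht, hK⟩ := (hf.fderiv_right (m := 1) (by norm_num)).exists_lipschitzOnWith
  have hdiff : ∀ᶠ w in 𝓝 z, DifferentiableAt ℝ f w :=
    (hf.eventually (by simp)).mono fun w hw => hw.differentiableAt (by norm_num)
  obtain ⟨r, hr, hball⟩ := Metric.eventually_nhds_iff_ball.1 (hdiff.and (eventually_mem_set.2 ht))
  refine IsBigO.of_bound K (Metric.eventually_nhds_iff_ball.2 ⟨r, hr, fun w hw => ?_⟩)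
  have hsub : Metric.closedBall z ‖w - z‖ ⊆ Metric.ball z r :=
    Metric.closedBall_subset_ball (by rwa [← dist_eq_norm])
  have hderiv : ∀ y ∈ Metric.closedBall z ‖w - z‖, ‖fderiv ℝ f y‖ ≤ K * ‖w - z‖ := fun y hy => by
    have := hK.dist_le_mul y (hball y (hsub hy)).2 z (mem_of_mem_nhds ht)
    rw [h0, dist_zero_right] at this
    exact this.trans (mul_le_mul_of_nonneg_left hy K.2)
  have hmean := (convex_closedBall z ‖w - z‖).norm_image_sub_le_of_norm_fderiv_le
    (fun y hy => (hball y (hsub hy)).1) hderiv (Metric.mem_closedBall_self (norm_nonneg _))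
    (by rw [Metric.mem_closedBall, dist_eq_norm])
  rwa [mul_assoc, ← sq, ← Real.norm_of_nonneg (sq_nonneg ‖w - z‖)] at hmean

theorem contDiffAt_clm_of_apply [FiniteDimensional ℝ K] {k : WithTop ℕ∞} {f : E → K →L[ℝ] F}
    {z : E} (h : ∀ y, ContDiffAt ℝ k (fun x => f x y) z) : ContDiffAt ℝ k f z := by
  let e₁ := ContinuousLinearEquiv.ofFinrankEq
    (Module.finrank_fin_fun ℝ (n := Module.finrank ℝ K)).symm
  let e₂ := (e₁.arrowCongr (1 : F ≃L[ℝ] F)).trans (ContinuousLinearEquiv.piRing _)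
  rw [← Function.id_comp f, ← e₂.symm_comp_self]
  exact e₂.symm.contDiff.contDiffAt.comp z (contDiffAt_pi.mpr fun i => h _)

theorem exists_contDiffAt_linear_solution [FiniteDimensional ℝ K] {A : E → K →ₗ[ℝ] K} {b : E → K}
    {z₀ : E} (hA : ∀ x, ContDiffAt ℝ 2 (fun z => A z x) z₀) (hinj : Function.Injective (A z₀))
    (hb : ContDiffAt ℝ 2 b z₀) (hb0 : b z₀ = 0) :
    ∃ x : E → K, ContDiffAt ℝ 2 x z₀ ∧ x z₀ = 0 ∧ (∀ᶠ z in 𝓝 z₀, ∀ y, A z y = b z ↔ y = x z) ∧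
      ∀ e, A z₀ (fderiv ℝ x z₀ e) = fderiv ℝ b z₀ e := by
  have : CompleteSpace K := FiniteDimensional.complete ℝ K
  let A' : E → K →L[ℝ] K := fun z => LinearMap.toContinuousLinearMap (A z)
  have hA' : ContDiffAt ℝ 2 A' z₀ := contDiffAt_clm_of_apply hA
  let e : K ≃L[ℝ] K := (LinearEquiv.ofInjectiveEndo (A z₀) hinj).toContinuousLinearEquiv
  have he : (e : K →L[ℝ] K) = A' z₀ := rfl
  let x : E → K := fun z => (A' z).inverse (b z)
  have hx : ContDiffAt ℝ 2 x z₀ :=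
    ((he ▸ contDiffAt_map_inverse e).comp z₀ hA').clm_apply hb
  have hsol : ∀ᶠ z in 𝓝 z₀, ∀ y, A z y = b z ↔ y = x z := by
    filter_upwards [hA'.continuousAt.eventually (he ▸ e.nhds)] with z ⟨e', he'⟩ y
    have happly : A z y = e' y := (DFunLike.congr_fun he' y).symm
    have hxz : x z = e'.symm (b z) := by simp [x, ← he']
    rw [happly, hxz]
    exact e'.eq_symm_apply.symm
  have hx0 : x z₀ = 0 := by simp only [x, hb0, map_zero]
  have hAx : (fun z => A' z (x z)) =ᶠ[𝓝 z₀] b := hsol.mono fun z hz => (hz _).2 rfl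
  have hderiv := ((hA'.differentiableAt (by norm_num)).hasFDerivAt.clm_apply
    (hx.differentiableAt (by norm_num)).hasFDerivAt).congr_of_eventuallyEq hAx.symm
  refine ⟨x, hx, hx0, hsol, fun v => ?_⟩
  simp [A', hderiv.fderiv, hx0]

/-- The linear map `(u, Q) ↦ (D u + B Q, C u)`. With `B` spanning a complement of the horizontal
space and `C` cutting it out, the Newton equation becomes a square linear system for this map. -/
def bordered (D : E →ₗ[ℝ] E) (B : K →ₗ[ℝ] E) (C : E →ₗ[ℝ] K) : E × K →ₗ[ℝ] E × K :=
  (D.coprod B).prod (C ∘ₗ LinearMap.fst ℝ E K)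

/-- The conditions under which the bordered system of `D`, `B`, `C` is nonsingular and determines
the image under `π` of its solution. In the application `D` is the derivative of the gradient field
at a critical point and `π` is the derivative of the map `(M, N) ↦ M Nᵀ`. -/
structure IsNondegenerateBordering (D : E →ₗ[ℝ] E) (B : K →ₗ[ℝ] E) (C : E →ₗ[ℝ] K)
    (π : E →ₗ[ℝ] F) : Prop where
  disjoint_range : Disjoint (LinearMap.range D) (LinearMap.range B)
  injective : Function.Injective B
  ker_le : LinearMap.ker D ≤ LinearMap.ker π
  disjoint_ker : Disjoint (LinearMap.ker C) (LinearMap.ker π)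

namespace IsNondegenerateBordering

variable {D : E →ₗ[ℝ] E} {B : K →ₗ[ℝ] E} {C : E →ₗ[ℝ] K} {π : E →ₗ[ℝ] F}

theorem eq_zero_and_map_eq (h : IsNondegenerateBordering D B C π) {u e : E} {Q : K}
    (heq : D u + B Q = D e) : Q = 0 ∧ π u = π e := by
  have hBQ : B Q = D (e - u) := by rw [map_sub, ← heq, add_sub_cancel_left]
  have hBQ0 : B Q = 0 :=
    Submodule.disjoint_def.1 h.disjoint_range _ ⟨_, hBQ.symm⟩ ⟨Q, rfl⟩
  refine ⟨h.injective (hBQ0.trans (map_zero B).symm), ?_⟩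
  have hmem : e - u ∈ LinearMap.ker π := h.ker_le (hBQ.symm.trans hBQ0)
  rw [LinearMap.mem_ker, map_sub, sub_eq_zero] at hmem
  exact hmem.symm

theorem injective_bordered (h : IsNondegenerateBordering D B C π) :
    Function.Injective (bordered D B C) := by
  refine (injective_iff_map_eq_zero _).2 fun ⟨u, Q⟩ huQ => ?_
  obtain ⟨hD, hC⟩ := Prod.ext_iff.1 huQ
  obtain ⟨hQ, hπ⟩ := h.eq_zero_and_map_eq (e := 0) (hD.trans (map_zero D).symm)
  have hu : u = 0 := Submodule.disjoint_def.1 h.disjoint_ker u hC (hπ.trans (map_zero π))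
  exact Prod.ext hu hQ

end IsNondegenerateBordering

/-- Near `z₀` the relation `newton` has on `T` the single solution `x z`, which depends smoothly on
`z`, vanishes at `z₀`, and to first order cancels the displacement `z - z₀` modulo the kernel of
`π`. -/
structure IsNewtonField (T : Set E) (newton : E → E → Prop) (π : E →ₗ[ℝ] F) (z₀ : E) (x : E → E) :
    Prop where
  contDiffAt : ContDiffAt ℝ 2 x z₀
  apply_eq_zero : x z₀ = 0
  newton_iff : ∀ᶠ z in 𝓝[T] z₀, ∀ u, newton z u ↔ u = x z
  map_fderiv : ∀ e, π (fderiv ℝ x z₀ e) = -π e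

theorem exists_isNewtonField [FiniteDimensional ℝ E] [FiniteDimensional ℝ K] {T : Set E}
    {newton : E → E → Prop} {z₀ : E} {D : E → E →ₗ[ℝ] E} {B : E → K →ₗ[ℝ] E} {C : E → E →ₗ[ℝ] K}
    {Y : E → E} {π : E →ₗ[ℝ] F} (hD : ∀ u, ContDiffAt ℝ 2 (fun z => D z u) z₀)
    (hB : ∀ Q, ContDiffAt ℝ 2 (fun z => B z Q) z₀) (hC : ∀ u, ContDiffAt ℝ 2 (fun z => C z u) z₀)
    (hY : ContDiffAt ℝ 2 Y z₀) (hY0 : Y z₀ = 0) (hDY : ∀ e, D z₀ e = fderiv ℝ Y z₀ e)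
    (hreg : IsNondegenerateBordering (D z₀) (B z₀) (C z₀) π)
    (hnewton : ∀ᶠ z in 𝓝[T] z₀, ∀ u, newton z u ↔ C z u = 0 ∧ ∃ Q, D z u + B z Q = -Y z) :
    ∃ x, IsNewtonField T newton π z₀ x := by
  have hb : ContDiffAt ℝ 2 (fun z => ((-Y z, 0) : E × K)) z₀ := hY.neg.prodMk contDiffAt_const
  have hbd : ∀ e, fderiv ℝ (fun z => ((-Y z, 0) : E × K)) z₀ e = (-D z₀ e, 0) := fun e => by
    have hYd := (hY.differentiableAt (by norm_num)).hasFDerivAt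
    exact (DFunLike.congr_fun (hYd.neg.prodMk (hasFDerivAt_const (0 : K) z₀)).fderiv e).trans
      (by simp [hDY])
  obtain ⟨x, hx, hx0, hsol, hder⟩ := exists_contDiffAt_linear_solution
    (A := fun z => bordered (D z) (B z) (C z))
    (fun q => ((hD q.1).add (hB q.2)).prodMk (hC q.1)) hreg.injective_bordered hb (by simp [hY0])
  refine ⟨fun z => (x z).1, hx.fst, by simp [hx0], ?_, fun e => ?_⟩
  · filter_upwards [hnewton, hsol.filter_mono nhdsWithin_le_nhds] with z hz hsolz u
    rw [hz]
    constructor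
    · rintro ⟨hCu, Q, hQ⟩
      exact congr_arg Prod.fst ((hsolz (u, Q)).1 (Prod.ext hQ hCu))
    · rintro rfl
      obtain ⟨hQ, hCu⟩ := Prod.ext_iff.1 ((hsolz (x z)).2 rfl)
      exact ⟨hCu, _, hQ⟩
  · have hDe : D z₀ (fderiv ℝ x z₀ e).1 + B z₀ (fderiv ℝ x z₀ e).2 = D z₀ (-e) := by
      rw [map_neg]
      exact congr_arg Prod.fst ((hder e).trans (hbd e))
    rw [(hx.differentiableAt (by norm_num)).hasFDerivAt.fst.fderiv, ← map_neg]
    exact (hreg.eq_zero_and_map_eq hDe).2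

/-- Near `z`, `e w u` is a retraction in the sense of optimization on manifolds: the point reached
from `w` in the direction `u`, which to first order is `w + u`. -/
structure IsRetractionAt (e : E → E → E) (z : E) : Prop where
  contDiffAt : ContDiffAt ℝ 2 (fun q : E × E => e q.1 q.2) (z, 0)
  apply_zero : ∀ w, e w 0 = w
  hasDerivAt_ray : ∀ b, HasDerivAt (fun t : ℝ => e z (t • b)) b 0

theorem IsRetractionAt.fderiv_uncurry {e : E → E → E} {z : E} (he : IsRetractionAt e z) (a b : E) :
    fderiv ℝ (fun q : E × E => e q.1 q.2) (z, 0) (a, b) = a + b := by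
  have hed := (he.contDiffAt.differentiableAt (by norm_num)).hasFDerivAt
  have hbase : fderiv ℝ (fun q : E × E => e q.1 q.2) (z, 0) (a, 0) = a := by
    have hcomp := HasFDerivAt.comp (f := fun w => (w, (0 : E))) z hed (hasFDerivAt_prodMk_left z 0)
    have hid : HasFDerivAt (fun w => e w 0) (ContinuousLinearMap.id ℝ E) z := by
      simp only [he.apply_zero]
      exact hasFDerivAt_id z
    exact DFunLike.congr_fun (hcomp.unique hid) a
  have hfibre : fderiv ℝ (fun q : E × E => e q.1 q.2) (z, 0) (0, b) = b := by
    have hline : HasDerivAt (fun t : ℝ => (z, t • b)) (0, b) 0 := by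
      simpa using (hasDerivAt_const (0 : ℝ) z).prodMk ((hasDerivAt_id (0 : ℝ)).smul_const b)
    exact (hed.comp_hasDerivAt_of_eq (0 : ℝ) hline (by simp)).unique (he.hasDerivAt_ray b)
  conv_rhs => rw [← hbase, ← hfibre, ← map_add, Prod.mk_add_mk, add_zero, zero_add]

theorem isRetractionAt_add (z : E) : IsRetractionAt (fun w u : E => w + u) z :=
  ⟨contDiffAt_fst.add contDiffAt_snd, add_zero,
    fun b => by simpa using ((hasDerivAt_id (0 : ℝ)).smul_const b).const_add z⟩

namespace IsNewtonField

variable {T : Set E} {newton : E → E → Prop} {π : E →ₗ[ℝ] F} {z₀ : E} {x : E → E} {e : E → E → E}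

theorem contDiffAt_retraction (hx : IsNewtonField T newton π z₀ x) (he : IsRetractionAt e z₀) :
    ContDiffAt ℝ 2 (fun z => e z (x z)) z₀ :=
  ContDiffAt.comp (g := fun q : E × E => e q.1 q.2) z₀
    (hx.apply_eq_zero.symm ▸ he.contDiffAt) (contDiffAt_id.prodMk hx.contDiffAt)

theorem retraction_apply_self (hx : IsNewtonField T newton π z₀ x) (he : IsRetractionAt e z₀) :
    e z₀ (x z₀) = z₀ := by
  rw [hx.apply_eq_zero, he.apply_zero]

theorem map_fderiv_retraction (hx : IsNewtonField T newton π z₀ x) (he : IsRetractionAt e z₀)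
    (v : E) : π (fderiv ℝ (fun z => e z (x z)) z₀ v) = 0 := by
  have hxd := (hx.contDiffAt.differentiableAt (by norm_num)).hasFDerivAt
  have hed : HasFDerivAt (fun q : E × E => e q.1 q.2)
      (fderiv ℝ (fun q : E × E => e q.1 q.2) (z₀, 0)) (z₀, x z₀) := by
    rw [hx.apply_eq_zero]
    exact (he.contDiffAt.differentiableAt (by norm_num)).hasFDerivAt
  have hv : fderiv ℝ (fun z => e z (x z)) z₀ v = v + fderiv ℝ x z₀ v :=
    (DFunLike.congr_fun (hed.comp z₀ ((hasFDerivAt_id z₀).prodMk hxd)).fderiv v).trans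
      (he.fderiv_uncurry v (fderiv ℝ x z₀ v))
  rw [hv, map_add, hx.map_fderiv, add_neg_cancel]

theorem isBigO_sq (hx : IsNewtonField T newton π z₀ x) (he : IsRetractionAt e z₀) {g : E → F}
    (hg : ContDiffAt ℝ 2 g z₀) (hπ : ∀ v, fderiv ℝ g z₀ v = π v) :
    (fun z => g (e z (x z)) - g z₀) =O[𝓝 z₀] fun z => ‖z - z₀‖ ^ 2 := by
  have hself := hx.retraction_apply_self he
  have hg' : ContDiffAt ℝ 2 g (e z₀ (x z₀)) := by rwa [hself]
  have hderiv : fderiv ℝ (fun z => g (e z (x z))) z₀ = 0 := by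
    have hcomp := ((hg'.differentiableAt (by norm_num)).hasFDerivAt.comp z₀
      ((hx.contDiffAt_retraction he).differentiableAt (by norm_num)).hasFDerivAt).fderiv
    refine ContinuousLinearMap.ext fun v => (DFunLike.congr_fun hcomp v).trans ?_
    rw [hself]
    exact (hπ _).trans (hx.map_fderiv_retraction he v)
  have hsmooth : ContDiffAt ℝ 2 (fun z => g (e z (x z))) z₀ :=
    ContDiffAt.comp (g := g) z₀ hg' (hx.contDiffAt_retraction he)
  simpa only [hself] using isBigO_sub_sq_of_fderiv_eq_zero hsmooth hderiv

end IsNewtonField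

end Analysis

section QuadraticConvergence

variable {E : Type*} [NormedAddCommGroup E]

theorem tendsto_of_quadratic_bound {x : ℕ → E} {a : E} {C : ℝ} (hC : 0 ≤ C)
    (h0 : C * ‖x 0 - a‖ ≤ 1 / 2) (h : ∀ k, ‖x (k + 1) - a‖ ≤ C * ‖x k - a‖ ^ 2) :
    Tendsto x atTop (𝓝 a) := by
  have hgeo : ∀ k, ‖x k - a‖ ≤ (1 / 2) ^ k * ‖x 0 - a‖ := fun k => by
    induction k with
    | zero => simp
    | succ k ih =>
      have hle : ‖x k - a‖ ≤ ‖x 0 - a‖ :=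
        ih.trans (mul_le_of_le_one_left (norm_nonneg _) (pow_le_one₀ (by norm_num) (by norm_num)))
      calc ‖x (k + 1) - a‖ ≤ C * ‖x k - a‖ * ‖x k - a‖ := by rw [mul_assoc, ← sq]; exact h k
        _ ≤ C * ‖x 0 - a‖ * ((1 / 2) ^ k * ‖x 0 - a‖) := by gcongr
        _ ≤ 1 / 2 * ((1 / 2) ^ k * ‖x 0 - a‖) := by gcongr
        _ = (1 / 2) ^ (k + 1) * ‖x 0 - a‖ := by ring
  refine tendsto_iff_norm_sub_tendsto_zero.2 (squeeze_zero (fun _ => norm_nonneg _) hgeo ?_)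
  simpa using (tendsto_pow_atTop_nhds_zero_of_lt_one (r := (1 / 2 : ℝ)) (by norm_num)
    (by norm_num)).mul_const ‖x 0 - a‖

theorem isLittleO_of_quadratic_bound {x : ℕ → E} {a : E} {C : ℝ} (hx : Tendsto x atTop (𝓝 a))
    (h : ∀ k, ‖x (k + 1) - a‖ ≤ C * ‖x k - a‖ ^ 2) :
    (fun k => x (k + 1) - a) =o[atTop] fun k => x k - a := by
  have hbig : (fun k => x (k + 1) - a) =O[atTop] fun k => ‖x k - a‖ ^ 2 :=
    IsBigO.of_bound C (.of_forall fun k => by simpa using h k)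
  exact hbig.trans_isLittleO
    ((isLittleO_norm_pow_id one_lt_two).comp_tendsto (tendsto_sub_nhds_zero_iff.2 hx))

theorem exists_ball_forall_step {S : Set E} {a : E} {step : E → E → Prop} {C : ℝ}
    (h : ∀ᶠ x in 𝓝[S] a, ∃ x' ∈ S, step x x' ∧ ‖x' - a‖ ≤ C * ‖x - a‖ ^ 2) :
    ∃ r > 0, ∃ D ≥ 0, D * r ≤ 1 / 2 ∧ ∀ x ∈ S ∩ Metric.ball a r,
      ∃ x' ∈ S ∩ Metric.ball a r, step x x' ∧ ‖x' - a‖ ≤ D * ‖x - a‖ ^ 2 := by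
  obtain ⟨r, hr, hball⟩ := Metric.eventually_nhds_iff_ball.1 (eventually_nhdsWithin_iff.1 h)
  have hD : 0 < |C| + 1 := by positivity
  have hDr : (|C| + 1) * min r (1 / (2 * (|C| + 1))) ≤ 1 / 2 := by
    calc _ ≤ (|C| + 1) * (1 / (2 * (|C| + 1))) := by gcongr; exact min_le_right _ _
      _ = 1 / 2 := by field_simp
  refine ⟨_, lt_min hr (by positivity), _, hD.le, hDr, fun x ⟨hxS, hx⟩ => ?_⟩
  obtain ⟨x', hx', hstep, hC⟩ := hball x (Metric.ball_subset_ball (min_le_left _ _) hx) hxS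
  have hquad : ‖x' - a‖ ≤ (|C| + 1) * ‖x - a‖ ^ 2 :=
    hC.trans (by gcongr; linarith [le_abs_self C])
  rw [Metric.mem_ball, dist_eq_norm] at hx
  have hhalf : ‖x' - a‖ ≤ 1 / 2 * ‖x - a‖ := by
    rw [sq, ← mul_assoc] at hquad
    exact hquad.trans (by gcongr; exact (mul_le_mul_of_nonneg_left hx.le hD.le).trans hDr)
  refine ⟨x', ⟨hx', ?_⟩, hstep, hquad⟩
  rw [Metric.mem_ball, dist_eq_norm]
  linarith [norm_nonneg (x - a)]

end QuadraticConvergence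

theorem locallyQuadraticallyConvergent_of_eventually {m n p : ℕ}
    {step : Mat m n → Mat m n → Prop}
    {Xs : Mat m n} {C : ℝ} (h : ∀ᶠ X in 𝓝[Mp m n p] Xs,
      ∃ X' ∈ Mp m n p, step X X' ∧ ‖X' - Xs‖ ≤ C * ‖X - Xs‖ ^ 2) :
    LocallyQuadraticallyConvergent p step Xs := by
  obtain ⟨r, hr, D, hD, hDr, hnext⟩ := exists_ball_forall_step h
  choose! next hmem hstep hquad using hnext
  refine ⟨Mp m n p ∩ Metric.ball Xs r, Set.inter_subset_left,
    inter_mem self_mem_nhdsWithin (mem_nhdsWithin_of_mem_nhds (Metric.ball_mem_nhds Xs hr)), D,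
    fun X₀ hX₀ => ?_⟩
  have hiter : ∀ k, next^[k] X₀ ∈ Mp m n p ∩ Metric.ball Xs r := fun k =>
    (show Set.MapsTo next _ _ from hmem).iterate k hX₀
  have hbound : ∀ k, ‖next^[k + 1] X₀ - Xs‖ ≤ D * ‖next^[k] X₀ - Xs‖ ^ 2 := fun k => by
    rw [Function.iterate_succ_apply']
    exact hquad _ (hiter k)
  have hlim : Tendsto (fun k => next^[k] X₀) atTop (𝓝 Xs) := by
    refine tendsto_of_quadratic_bound hD (le_trans ?_ hDr) hbound
    gcongr
    exact (mem_ball_iff_norm.1 hX₀.2).le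
  refine ⟨fun k => next^[k] X₀, rfl, fun k => (hiter k).1, fun k => ?_, hlim,
    isLittleO_of_quadratic_bound hlim hbound, hbound⟩
  simpa only [Function.iterate_succ_apply'] using hstep _ (hiter k)

/-! ### Matrix calculus -/

section MatrixCalculus

variable {E : Type*} [NormedAddCommGroup E] [NormedSpace ℝ E] {k : WithTop ℕ∞} {x : E}
  {a b c : Type*} [Fintype a] [Fintype b] [Fintype c]

theorem isBoundedBilinearMap_matrix_mul :
    IsBoundedBilinearMap ℝ (fun q : Matrix a b ℝ × Matrix b c ℝ => q.1 * q.2) where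
  add_left _ _ _ := Matrix.add_mul _ _ _
  smul_left _ _ _ := Matrix.smul_mul _ _ _
  add_right _ _ _ := Matrix.mul_add _ _ _
  smul_right _ _ _ := Matrix.mul_smul _ _ _
  bound := ⟨1, one_pos, fun A B => by simpa using Matrix.frobenius_norm_mul A B⟩

@[fun_prop]
theorem contDiffAt_matrix_mul {f : E → Matrix a b ℝ} {g : E → Matrix b c ℝ}
    (hf : ContDiffAt ℝ k f x) (hg : ContDiffAt ℝ k g x) : ContDiffAt ℝ k (fun y => f y * g y) x :=
  isBoundedBilinearMap_matrix_mul.contDiff.contDiffAt.comp x (hf.prodMk hg)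

theorem hasDerivAt_matrix_mul {r s : Type*} [Finite r] [Finite s] {f : ℝ → Matrix r b ℝ}
    {g : ℝ → Matrix b s ℝ} {f' : Matrix r b ℝ} {g' : Matrix b s ℝ} {t : ℝ}
    (hf : HasDerivAt f f' t) (hg : HasDerivAt g g' t) :
    HasDerivAt (fun y => f y * g y) (f t * g' + f' * g t) t := by
  cases nonempty_fintype r
  cases nonempty_fintype s
  have h := (isBoundedBilinearMap_matrix_mul (a := r) (b := b) (c := s)).hasFDerivAt (f t, g t)
  exact h.comp_hasDerivAt t (hf.prodMk hg)

theorem contDiffAt_linearMap_comp {V W : Type*} [NormedAddCommGroup V] [NormedSpace ℝ V]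
    [FiniteDimensional ℝ V] [NormedAddCommGroup W] [NormedSpace ℝ W] (L : V →ₗ[ℝ] W) {f : E → V}
    (hf : ContDiffAt ℝ k f x) : ContDiffAt ℝ k (fun y => L (f y)) x :=
  (LinearMap.toContinuousLinearMap L).contDiff.contDiffAt.comp x hf

@[fun_prop]
theorem contDiffAt_matrix_transpose {f : E → Matrix a b ℝ} (hf : ContDiffAt ℝ k f x) :
    ContDiffAt ℝ k (fun y => (f y)ᵀ) x :=
  contDiffAt_linearMap_comp (Matrix.transposeLinearEquiv a b ℝ ℝ).toLinearMap hf

attribute [local instance] Matrix.frobeniusNormedRing Matrix.frobeniusNormedAlgebra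

theorem contDiffAt_matrix_inv [DecidableEq a] {f : E → Matrix a a ℝ} (hf : ContDiffAt ℝ k f x)
    (hx : IsUnit (f x).det) : ContDiffAt ℝ k (fun y => (f y)⁻¹) x := by
  have : CompleteSpace (Matrix a a ℝ) := FiniteDimensional.complete ℝ _
  obtain ⟨u, hu⟩ := (Matrix.isUnit_iff_isUnit_det _).2 hx
  simp only [Matrix.nonsing_inv_eq_ringInverse]
  exact (hu ▸ contDiffAt_ringInverse ℝ u).comp x hf

@[fun_prop]
theorem contDiffAt_matrix_exp [DecidableEq a] {f : E → Matrix a a ℝ} (hf : ContDiffAt ℝ k f x) :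
    ContDiffAt ℝ k (fun y => NormedSpace.exp (f y)) x := by
  have : CompleteSpace (Matrix a a ℝ) := FiniteDimensional.complete ℝ _
  exact (NormedSpace.exp_analytic (𝕂 := ℝ) (f x)).contDiffAt.comp x hf

theorem hasDerivAt_matrix_exp_smul_zero [DecidableEq a] (A : Matrix a a ℝ) :
    HasDerivAt (fun t : ℝ => NormedSpace.exp (t • A)) A 0 := by
  have : CompleteSpace (Matrix a a ℝ) := FiniteDimensional.complete ℝ _
  have h := hasDerivAt_exp_smul_const (𝕂 := ℝ) A (0 : ℝ)
  simp only [zero_smul, NormedSpace.exp_zero, one_mul] at h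
  exact h

end MatrixCalculus

/-! ### Full-rank matrices and factorizations -/

section Rank

variable {a b c : ℕ} {M : Mat a b}

/-- The Moore–Penrose left inverse `(MᵀM)⁻¹Mᵀ` of a matrix `M` of full column rank. -/
noncomputable def pinv (M : Mat a b) : Mat b a := (Mᵀ * M)⁻¹ * Mᵀ

theorem pinv_mul (hM : M.rank = b) : pinv M * M = 1 := by
  rw [pinv, Matrix.mul_assoc, Matrix.nonsing_inv_mul _ (isUnit_gram hM)]

theorem transpose_mul_transpose_pinv (hM : M.rank = b) : Mᵀ * (pinv M)ᵀ = 1 := by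
  rw [← Matrix.transpose_mul, pinv_mul hM, Matrix.transpose_one]

theorem rank_eq_of_mul_eq_one {L : Mat b a} (h : L * M = 1) : M.rank = b := by
  refine le_antisymm (by simpa using M.rank_le_width) ?_
  simpa [h] using Matrix.rank_mul_le_right L M

theorem rank_eq_iff_isUnit_gram : M.rank = b ↔ IsUnit (Mᵀ * M).det := by
  refine ⟨isUnit_gram, fun h => rank_eq_of_mul_eq_one (L := pinv M) ?_⟩
  rw [pinv, Matrix.mul_assoc, Matrix.nonsing_inv_mul _ h]

theorem isOpen_rank_eq (a b : ℕ) : IsOpen {M : Mat a b | M.rank = b} := by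
  simp only [rank_eq_iff_isUnit_gram, isUnit_iff_ne_zero]
  exact isOpen_ne.preimage (by fun_prop)

theorem mul_left_cancel_of_rank_eq (hM : M.rank = b) {A B : Mat b c} (h : M * A = M * B) :
    A = B := by
  have := congr_arg (pinv M * ·) h
  simpa only [← Matrix.mul_assoc, pinv_mul hM, Matrix.one_mul] using this

theorem contDiffAt_pinv {E : Type*} [NormedAddCommGroup E] [NormedSpace ℝ E] {k : WithTop ℕ∞}
    {x : E} {f : E → Mat a b} (hf : ContDiffAt ℝ k f x) (hx : (f x).rank = b) :
    ContDiffAt ℝ k (fun y => pinv (f y)) x :=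
  contDiffAt_matrix_mul (contDiffAt_matrix_inv (by fun_prop) (isUnit_gram hx)) (by fun_prop)

end Rank

section Factorization

variable {m n p : ℕ}

theorem isOpen_Rp : IsOpen (Rp m n p) :=
  ((isOpen_rank_eq m p).preimage continuous_fst).inter
    ((isOpen_rank_eq n p).preimage continuous_snd)

theorem SRp_subset_Rp : SRp m n p ⊆ Rp m n p := fun _ hz => ⟨rank_eq_of_mul_eq_one hz.1, hz.2⟩

theorem pinv_mul_proj {z : Pair m n p} (hz : z.1.rank = p) : pinv z.1 * proj z = z.2ᵀ := by
  rw [proj, ← Matrix.mul_assoc, pinv_mul hz, Matrix.one_mul]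

theorem proj_mul_transpose_pinv {z : Pair m n p} (hz : z.2.rank = p) :
    proj z * (pinv z.2)ᵀ = z.1 := by
  rw [proj, Matrix.mul_assoc, transpose_mul_transpose_pinv hz, Matrix.mul_one]

theorem proj_mem {z : Pair m n p} (hz : z ∈ Rp m n p) : proj z ∈ Mp m n p := by
  refine le_antisymm ((Matrix.rank_mul_le_left _ _).trans hz.1.le) ?_
  calc p = z.2ᵀ.rank := by rw [Matrix.rank_transpose, hz.2]
    _ = (pinv z.1 * proj z).rank := by rw [pinv_mul_proj hz.1]
    _ ≤ (proj z).rank := Matrix.rank_mul_le_right _ _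

theorem mem_Rp_of_proj_mem {z : Pair m n p} (hz : proj z ∈ Mp m n p) : z ∈ Rp m n p := by
  have hrank : (z.1 * z.2ᵀ).rank = p := hz
  refine ⟨le_antisymm (by simpa using z.1.rank_le_width) ?_,
    le_antisymm (by simpa using z.2.rank_le_width) ?_⟩
  · exact hrank.ge.trans (Matrix.rank_mul_le_left _ _)
  · exact hrank.ge.trans ((Matrix.rank_mul_le_right _ _).trans (Matrix.rank_transpose _).le)

/-- The action of the general linear group on pairs of factors; its orbits in `Rp m n p` are the
fibres of `proj`. -/
noncomputable def act (R : (Mat p p)ˣ) : Pair m n p ≃L[ℝ] Pair m n p :=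
  LinearEquiv.toContinuousLinearEquiv
    { toFun := fun z => (z.1 * (R : Mat p p), z.2 * (↑R⁻¹ : Mat p p)ᵀ)
      invFun := fun z => (z.1 * (↑R⁻¹ : Mat p p), z.2 * (R : Mat p p)ᵀ)
      map_add' := fun _ _ => by
        simp only [Prod.fst_add, Prod.snd_add, Matrix.add_mul, Prod.mk_add_mk]
      map_smul' := fun _ _ => by
        simp only [Prod.smul_fst, Prod.smul_snd, Matrix.smul_mul, Prod.smul_mk, RingHom.id_apply]
      left_inv := fun z => by
        simp only [Matrix.mul_assoc, ← Matrix.transpose_mul, Units.mul_inv, Matrix.transpose_one,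
          Matrix.mul_one]
      right_inv := fun z => by
        simp only [Matrix.mul_assoc, ← Matrix.transpose_mul, Units.inv_mul, Matrix.transpose_one,
          Matrix.mul_one] }

theorem act_fst (R : (Mat p p)ˣ) (z : Pair m n p) : (act R z).1 = z.1 * (R : Mat p p) :=
  rfl

theorem act_snd (R : (Mat p p)ˣ) (z : Pair m n p) : (act R z).2 = z.2 * (↑R⁻¹ : Mat p p)ᵀ := rfl

theorem proj_act (R : (Mat p p)ˣ) (z : Pair m n p) : proj (act R z) = proj z := by
  rw [proj, act_fst, act_snd, Matrix.transpose_mul, Matrix.transpose_transpose, Matrix.mul_assoc,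
    ← Matrix.mul_assoc (R : Mat p p), Units.mul_inv, Matrix.one_mul, proj]

theorem act_mem_Rp (R : (Mat p p)ˣ) {z : Pair m n p} (hz : z ∈ Rp m n p) : act R z ∈ Rp m n p :=
  mem_Rp_of_proj_mem (by rw [proj_act]; exact proj_mem hz)

theorem fst_eq_mul_of_proj_eq {z z' : Pair m n p} (hz' : z' ∈ Rp m n p) (h : proj z = proj z') :
    z'.1 = z.1 * (z.2ᵀ * (pinv z'.2)ᵀ) := by
  rw [← Matrix.mul_assoc, ← proj, h, proj_mul_transpose_pinv hz'.2]

theorem exists_act_eq {z z' : Pair m n p} (hz : z ∈ Rp m n p) (hz' : z' ∈ Rp m n p)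
    (h : proj z = proj z') : ∃ R, act R z = z' := by
  have hfst := fst_eq_mul_of_proj_eq hz' h
  have hfst' := fst_eq_mul_of_proj_eq hz h.symm
  set R := z.2ᵀ * (pinv z'.2)ᵀ
  set R' := z'.2ᵀ * (pinv z.2)ᵀ
  have hRR' : R * R' = 1 := mul_left_cancel_of_rank_eq hz.1 (by
    rw [← Matrix.mul_assoc, ← hfst, ← hfst', Matrix.mul_one])
  have hsnd : z'.2ᵀ = R' * z.2ᵀ := mul_left_cancel_of_rank_eq hz'.1 (by
    rw [← Matrix.mul_assoc, ← hfst']; exact h.symm)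
  refine ⟨⟨R, R', hRR', mul_eq_one_comm.1 hRR'⟩, Prod.ext hfst.symm ?_⟩
  rw [← Matrix.transpose_transpose z'.2, hsnd, Matrix.transpose_mul, Matrix.transpose_transpose]
  rfl

theorem exists_mem_Rp {X : Mat m n} (hX : X ∈ Mp m n p) : ∃ z ∈ Rp m n p, proj z = X := by
  let b := Module.finBasisOfFinrankEq ℝ (LinearMap.range X.mulVecLin) hX
  have hcol : ∀ k, X.col k ∈ LinearMap.range X.mulVecLin := fun k => ⟨Pi.single k 1, by simp⟩
  let M : Mat m p := Matrix.of fun i j => (b j : Fin m → ℝ) i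
  let N : Mat n p := Matrix.of fun k j => b.repr ⟨_, hcol k⟩ j
  have hproj : proj (M, N) = X := by
    ext i k
    have hsum := congr_fun (congr_arg Subtype.val (b.sum_repr ⟨_, hcol k⟩)) i
    simp only [Submodule.coe_sum, Submodule.coe_smul, Finset.sum_apply, Pi.smul_apply,
      smul_eq_mul, Matrix.col_apply] at hsum
    rw [proj, Matrix.mul_apply, ← hsum]
    exact Finset.sum_congr rfl fun j _ => mul_comm (M i j) (N k j)
  exact ⟨(M, N), mem_Rp_of_proj_mem (hproj ▸ hX), hproj⟩

theorem exists_contDiffAt_section {z₀ : Pair m n p} (hz₀ : z₀ ∈ Rp m n p) :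
    ∃ σ : Mat m n → Pair m n p, ContDiffAt ℝ 1 σ (proj z₀) ∧ σ (proj z₀) = z₀ ∧
      ∀ᶠ X in 𝓝[Mp m n p] proj z₀, σ X ∈ Rp m n p ∧ proj (σ X) = X := by
  let K : Mat n p := (pinv z₀.2)ᵀ
  have hK : proj z₀ * K = z₀.1 := proj_mul_transpose_pinv hz₀.2
  have hXK : ContDiffAt ℝ 1 (fun X : Mat m n => X * K) (proj z₀) := by fun_prop
  have hK_rank : (proj z₀ * K).rank = p := by rw [hK, hz₀.1]
  have hrank : ∀ᶠ X in 𝓝 (proj z₀), (X * K).rank = p :=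
    hXK.continuousAt.eventually ((isOpen_rank_eq m p).mem_nhds hK_rank)
  have hpinv : ContDiffAt ℝ 1 (fun X : Mat m n => pinv (X * K)) (proj z₀) :=
    contDiffAt_pinv hXK hK_rank
  refine ⟨fun X => (X * K, (pinv (X * K) * X)ᵀ), by fun_prop, ?_, ?_⟩
  · simp only [hK, pinv_mul_proj hz₀.1, Matrix.transpose_transpose]
  · filter_upwards [hrank.filter_mono nhdsWithin_le_nhds, self_mem_nhdsWithin] with X hrankX hX
    obtain ⟨w, hw, rfl⟩ := exists_mem_Rp hX
    have hpinv_mul : pinv (proj w * K) * w.1 * (w.2ᵀ * K) = 1 := by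
      rw [Matrix.mul_assoc, ← Matrix.mul_assoc w.1, ← proj, pinv_mul hrankX]
    let R : (Mat p p)ˣ := ⟨w.2ᵀ * K, _, mul_eq_one_comm.1 hpinv_mul, hpinv_mul⟩
    have hfst : proj w * K = (act R w).1 := by rw [act_fst, proj, Matrix.mul_assoc]
    have hσ : (proj w * K, (pinv (proj w * K) * proj w)ᵀ) = act R w := by
      rw [hfst, ← proj_act R, pinv_mul_proj (hfst ▸ hrankX), Matrix.transpose_transpose]
    rw [hσ]
    exact ⟨act_mem_Rp R hw, proj_act R w⟩

end Factorization

/-! ### Orthonormalization of the first factor -/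

section Orthonormalization

variable {m n p : ℕ}

theorem sq_norm_eq_trace {a b : ℕ} (A : Mat a b) : ‖A‖ ^ 2 = (Aᵀ * A).trace := by
  have h : 0 ≤ ∑ i, ∑ j, ‖A i j‖ ^ (2 : ℝ) := by positivity
  rw [Matrix.frobenius_norm_def, ← Real.sqrt_eq_rpow, Real.sq_sqrt h, Finset.sum_comm]
  simp [Matrix.trace, Matrix.mul_apply, sq]

theorem norm_sub_one_le_of_posSemidef {S : Mat p p} (hS : S.PosSemidef) :
    ‖S - 1‖ ≤ ‖S * S - 1‖ := by
  have hSt : Sᵀ = S := by simpa using hS.isHermitian.eq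
  have hDt : (S - 1)ᵀ = S - 1 := by rw [Matrix.transpose_sub, hSt, Matrix.transpose_one]
  have hsq : 0 ≤ ((S * (S - 1))ᵀ * (S * (S - 1))).trace := by
    rw [← sq_norm_eq_trace]
    positivity
  have hconj : 0 ≤ ((S - 1) * S * (S - 1)).trace := by
    have h := (hS.conjTranspose_mul_mul_same (S - 1)).trace_nonneg
    rwa [Matrix.conjTranspose_eq_transpose_of_trivial, hDt] at h
  have hexpand : (S * S - 1)ᵀ * (S * S - 1) = (S - 1)ᵀ * (S - 1)
      + (S * (S - 1))ᵀ * (S * (S - 1)) + (2 : ℝ) • ((S - 1) * S * (S - 1)) := by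
    simp only [Matrix.transpose_mul, Matrix.transpose_sub, hSt, Matrix.transpose_one, two_smul]
    noncomm_ring
  refine le_of_sq_le_sq ?_ (norm_nonneg _)
  rw [sq_norm_eq_trace, sq_norm_eq_trace, hexpand, Matrix.trace_add, Matrix.trace_add,
    Matrix.trace_smul, smul_eq_mul]
  linarith

section GramSqrt

open scoped MatrixOrder

variable {a : ℕ} {M : Mat a p}

/-- The positive semidefinite square root of the Gram matrix `MᵀM`. -/
noncomputable def gramSqrt (M : Mat a p) : Mat p p := CFC.sqrt (Mᵀ * M)

theorem posSemidef_gramSqrt (M : Mat a p) : (gramSqrt M).PosSemidef :=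
  Matrix.nonneg_iff_posSemidef.1 (CFC.sqrt_nonneg _)

theorem transpose_gramSqrt (M : Mat a p) : (gramSqrt M)ᵀ = gramSqrt M := by
  simpa using (posSemidef_gramSqrt M).isHermitian.eq

theorem gramSqrt_mul_self (M : Mat a p) : gramSqrt M * gramSqrt M = Mᵀ * M :=
  CFC.sqrt_mul_sqrt_self _
    (Matrix.PosSemidef.nonneg (by simpa using Matrix.posSemidef_conjTranspose_mul_self M))

theorem isUnit_det_gramSqrt (hM : M.rank = p) : IsUnit (gramSqrt M).det :=
  isUnit_of_mul_isUnit_left (by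
    rw [← Matrix.det_mul, gramSqrt_mul_self]
    exact isUnit_gram hM)

end GramSqrt

/-- The point of the fibre through `z` obtained by orthonormalizing the first factor with the
square root of its Gram matrix. -/
noncomputable def orthonormalize (z : Pair m n p) : Pair m n p :=
  (z.1 * (gramSqrt z.1)⁻¹, z.2 * gramSqrt z.1)

theorem proj_orthonormalize {z : Pair m n p} (hz : z ∈ Rp m n p) :
    proj (orthonormalize z) = proj z := by
  rw [proj, orthonormalize, Matrix.transpose_mul, transpose_gramSqrt, Matrix.mul_assoc,
    Matrix.nonsing_inv_mul_cancel_left _ _ (isUnit_det_gramSqrt hz.1), proj]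

theorem orthonormalize_mem {z : Pair m n p} (hz : z ∈ Rp m n p) :
    orthonormalize z ∈ SRp m n p := by
  refine ⟨?_, (mem_Rp_of_proj_mem ?_).2⟩
  · have hS := isUnit_det_gramSqrt hz.1
    rw [orthonormalize, Matrix.transpose_mul, Matrix.mul_assoc, ← Matrix.mul_assoc z.1ᵀ,
      ← gramSqrt_mul_self, Matrix.transpose_nonsing_inv, transpose_gramSqrt,
      Matrix.mul_nonsing_inv_cancel_right _ _ hS, Matrix.nonsing_inv_mul _ hS]
  · rw [proj_orthonormalize hz]
    exact proj_mem hz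

theorem isBigO_orthonormalize_sub {z₀ : Pair m n p} (hz₀ : z₀ ∈ SRp m n p) :
    (fun z => orthonormalize z - z₀) =O[𝓝 z₀] fun z => z - z₀ := by
  have hgram : (fun z : Pair m n p => z.1ᵀ * z.1 - 1) =O[𝓝 z₀] fun z => z - z₀ := by
    have hdiff : ContDiffAt ℝ 1 (fun z : Pair m n p => z.1ᵀ * z.1) z₀ := by fun_prop
    have hsub := (hdiff.differentiableAt one_ne_zero).isBigO_sub
    rw [hz₀.1] at hsub
    exact hsub
  have hsqrt : (fun z : Pair m n p => gramSqrt z.1 - 1) =O[𝓝 z₀] fun z => z - z₀ :=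
    (IsBigO.of_norm_le (g := fun z : Pair m n p => ‖z.1ᵀ * z.1 - 1‖) fun z => by
      rw [← gramSqrt_mul_self]
      exact norm_sub_one_le_of_posSemidef (posSemidef_gramSqrt z.1)).trans hgram.norm_left
  have hpair : (fun z : Pair m n p => (z, gramSqrt z.1) - (z₀, 1)) =O[𝓝 z₀] fun z => z - z₀ :=
    (isBigO_refl _ _).prod_left hsqrt
  have hlim : Tendsto (fun z : Pair m n p => (z, gramSqrt z.1)) (𝓝 z₀) (𝓝 (z₀, 1)) :=
    tendsto_sub_nhds_zero_iff.1
      (hpair.trans_tendsto (tendsto_sub_nhds_zero_iff.2 tendsto_id))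
  have hΘ : ContDiffAt ℝ 1 (fun q : Pair m n p × Mat p p => (q.1.1 * q.2⁻¹, q.1.2 * q.2))
      (z₀, 1) :=
    (contDiffAt_matrix_mul (by fun_prop) (contDiffAt_matrix_inv (by fun_prop) (by simp))).prodMk
      (by fun_prop)
  have hΘ_sub := ((hΘ.differentiableAt one_ne_zero).isBigO_sub.comp_tendsto hlim).trans hpair
  simpa [Function.comp_def, orthonormalize] using hΘ_sub

theorem exists_mem_SRp {X : Mat m n} (hX : X ∈ Mp m n p) : ∃ z ∈ SRp m n p, proj z = X := by
  obtain ⟨z, hz, rfl⟩ := exists_mem_Rp hX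
  exact ⟨_, orthonormalize_mem hz, proj_orthonormalize hz⟩

theorem exists_isBigO_section {z₀ : Pair m n p} (hz₀ : z₀ ∈ SRp m n p) :
    ∃ σ : Mat m n → Pair m n p,
      (fun X => σ X - z₀) =O[𝓝 (proj z₀)] (fun X => X - proj z₀) ∧
      ∀ᶠ X in 𝓝[Mp m n p] proj z₀, σ X ∈ SRp m n p ∧ proj (σ X) = X := by
  obtain ⟨σ, hσ, hσ₀, hmem⟩ := exists_contDiffAt_section (SRp_subset_Rp hz₀)
  have hlim : Tendsto σ (𝓝 (proj z₀)) (𝓝 z₀) := by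
    have h := hσ.continuousAt.tendsto
    rwa [hσ₀] at h
  have hσ_sub := (hσ.differentiableAt one_ne_zero).isBigO_sub
  rw [hσ₀] at hσ_sub
  refine ⟨fun X => orthonormalize (σ X),
    ((isBigO_orthonormalize_sub hz₀).comp_tendsto hlim).trans hσ_sub, hmem.mono fun X hX => ?_⟩
  exact ⟨orthonormalize_mem hX.1, (proj_orthonormalize hX.1).trans hX.2⟩

end Orthonormalization

/-! ### The differential of `(M, N) ↦ M Nᵀ` -/

section Projection

variable {m n p : ℕ} {z : Pair m n p}

/-- The differential of `proj` at `z`. -/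
def dproj (z : Pair m n p) : Pair m n p →ₗ[ℝ] Mat m n where
  toFun v := v.1 * z.2ᵀ + z.1 * v.2ᵀ
  map_add' v w := by
    simp only [Prod.fst_add, Prod.snd_add, Matrix.transpose_add, Matrix.add_mul, Matrix.mul_add]
    abel
  map_smul' c v := by simp

theorem dproj_apply (z v : Pair m n p) : dproj z v = v.1 * z.2ᵀ + z.1 * v.2ᵀ := rfl

theorem isBoundedBilinearMap_proj :
    IsBoundedBilinearMap ℝ (proj : Pair m n p → Mat m n) where
  add_left _ _ _ := Matrix.add_mul _ _ _
  smul_left _ _ _ := Matrix.smul_mul _ _ _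
  add_right _ _ _ := by rw [proj, Matrix.transpose_add, Matrix.mul_add, proj, proj]
  smul_right _ _ _ := by rw [proj, Matrix.transpose_smul, Matrix.mul_smul, proj]
  bound := ⟨1, one_pos, fun A B => by
    simpa [proj] using Matrix.frobenius_norm_mul A Bᵀ⟩

theorem hasFDerivAt_proj (z : Pair m n p) :
    HasFDerivAt proj (LinearMap.toContinuousLinearMap (dproj z)) z :=
  (isBoundedBilinearMap_proj.hasFDerivAt z).congr_fderiv
    (ContinuousLinearMap.ext fun _ => add_comm _ _)

@[fun_prop]
theorem contDiffAt_proj {k : WithTop ℕ∞} (z : Pair m n p) : ContDiffAt ℝ k proj z :=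
  isBoundedBilinearMap_proj.contDiff.contDiffAt

theorem dproj_mem (hz : z ∈ Rp m n p) (v : Pair m n p) :
    dproj z v ∈ tangentSpace (proj z) := (mem_tangentSpace_proj hz _).2 ⟨v, rfl⟩

theorem exists_dproj_eq (hz : z ∈ Rp m n p) {ξ : Mat m n} (hξ : ξ ∈ tangentSpace (proj z)) :
    ∃ v, dproj z v = ξ :=
  ((mem_tangentSpace_proj hz _).1 hξ).imp fun _ hv => hv.symm

/-- The tangent vector `(M R, -N Rᵀ)` to the fibre of `proj` through `(M, N)`. -/
def vert (z : Pair m n p) : Mat p p →ₗ[ℝ] Pair m n p where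
  toFun R := (z.1 * R, -(z.2 * Rᵀ))
  map_add' A B := by
    simp only [Matrix.transpose_add, Matrix.mul_add, neg_add, Prod.mk_add_mk]
  map_smul' c A := by simp

theorem vert_apply (z : Pair m n p) (R : Mat p p) : vert z R = (z.1 * R, -(z.2 * Rᵀ)) := rfl

theorem dproj_vert (z : Pair m n p) (R : Mat p p) : dproj z (vert z R) = 0 := by
  simp [dproj_apply, vert_apply, Matrix.mul_assoc, Matrix.transpose_mul]

theorem vert_injective (hz : z.1.rank = p) : Function.Injective (vert z) := fun _ _ h =>
  mul_left_cancel_of_rank_eq hz (congr_arg Prod.fst h)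

theorem exists_vert_eq (hz : z ∈ Rp m n p) {u : Pair m n p} (hu : dproj z u = 0) :
    ∃ R, vert z R = u := by
  have hfst : z.1 * -(u.2ᵀ * (pinv z.2)ᵀ) = u.1 := by
    have h := congr_arg (· * (pinv z.2)ᵀ) hu
    simp only [dproj_apply, Matrix.add_mul, Matrix.mul_assoc, transpose_mul_transpose_pinv hz.2,
      Matrix.mul_one, Matrix.zero_mul] at h
    rw [Matrix.mul_neg, ← eq_neg_of_add_eq_zero_left h]
  have hsnd : -(u.2ᵀ * (pinv z.2)ᵀ) * z.2ᵀ = -u.2ᵀ := mul_left_cancel_of_rank_eq hz.1 (by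
    rw [← Matrix.mul_assoc, hfst, Matrix.mul_neg]
    exact eq_neg_of_add_eq_zero_left hu)
  refine ⟨_, Prod.ext hfst ?_⟩
  rw [vert_apply, neg_eq_iff_eq_neg, ← Matrix.transpose_inj, Matrix.transpose_mul,
    Matrix.transpose_transpose, hsnd, Matrix.transpose_neg]

end Projection

/-! ### Smooth maps on the manifold of rank-`p` matrices -/

section SmoothOnMp

variable {m n p : ℕ} {F : Type*} [NormedAddCommGroup F] [NormedSpace ℝ F] {φ : Mat m n → F}

theorem SmoothOnMp.contDiffAt_comp_proj (hφ : SmoothOnMp p φ) {z : Pair m n p}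
    (hz : z ∈ Rp m n p) : ContDiffAt ℝ ∞ (fun w : Pair m n p => φ (proj w)) z := by
  obtain ⟨V, hV, hzV, Φ, hΦ, heq⟩ := hφ _ (proj_mem hz)
  have hcont : ContinuousAt (proj : Pair m n p → Mat m n) z :=
    (contDiffAt_proj (k := 0) z).continuousAt
  refine ((hΦ.contDiffAt (hV.mem_nhds hzV)).comp z (contDiffAt_proj z)).congr_of_eventuallyEq ?_
  filter_upwards [hcont.eventually (hV.mem_nhds hzV), isOpen_Rp.mem_nhds hz] with w hwV hw
  exact (heq _ ⟨hwV, proj_mem hw⟩).symm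

theorem SmoothOnMp.hasFDerivWithinAt (hφ : SmoothOnMp p φ) {X : Mat m n} (hX : X ∈ Mp m n p) :
    HasFDerivWithinAt φ (diffMp p φ X) (Mp m n p) X := by
  obtain ⟨V, hV, hXV, Φ, hΦ, heq⟩ := hφ X hX
  have hΦX : DifferentiableAt ℝ Φ X :=
    (hΦ.contDiffAt (hV.mem_nhds hXV)).differentiableAt (by simp)
  refine (hΦX.differentiableWithinAt.congr_of_eventuallyEq ?_
    (heq X ⟨hXV, hX⟩).symm).hasFDerivWithinAt
  filter_upwards [mem_nhdsWithin_of_mem_nhds (hV.mem_nhds hXV), self_mem_nhdsWithin] with Y hYV hY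
  exact (heq Y ⟨hYV, hY⟩).symm

theorem SmoothOnMp.fderiv_comp_proj (hφ : SmoothOnMp p φ) {z : Pair m n p} (hz : z ∈ Rp m n p)
    (v : Pair m n p) :
    fderiv ℝ (fun w : Pair m n p => φ (proj w)) z v = diffMp p φ (proj z) (dproj z v) := by
  have hcomp := (hφ.hasFDerivWithinAt (proj_mem hz)).comp_hasFDerivAt z (hasFDerivAt_proj z)
    (by filter_upwards [isOpen_Rp.mem_nhds hz] with w hw using proj_mem hw)
  exact DFunLike.congr_fun hcomp.fderiv v

end SmoothOnMp

/-! ### Nondegenerate critical points in terms of the lifted function -/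

section Hessian

variable {m n p : ℕ}

/-- The lift to pairs of factors of the vector field `X ↦ A X + X B`. -/
def linLift (A : Mat m m) (B : Mat n n) : Pair m n p →ₗ[ℝ] Pair m n p where
  toFun z := (A * z.1, Bᵀ * z.2)
  map_add' _ _ := by simp [Matrix.mul_add]
  map_smul' _ _ := by simp

theorem dproj_linLift (A : Mat m m) (B : Mat n n) (z : Pair m n p) :
    dproj z (linLift A B z) = A * proj z + proj z * B := by
  simp [dproj_apply, linLift, proj, Matrix.mul_assoc, Matrix.transpose_mul]

theorem exists_linLift_eq {z : Pair m n p} (hz : z ∈ Rp m n p) (v : Pair m n p) :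
    ∃ (A : Mat m m) (B : Mat n n), linLift A B z = v :=
  ⟨v.1 * pinv z.1, (v.2 * pinv z.2)ᵀ, by
    simp [linLift, Matrix.mul_assoc, pinv_mul hz.1, pinv_mul hz.2]⟩

theorem isVectorField_lin (A : Mat m m) (B : Mat n n) :
    IsVectorField p fun X : Mat m n => A * X + X * B :=
  ⟨fun _ _ => ⟨Set.univ, isOpen_univ, trivial, _,
    (contDiff_iff_contDiffAt.2 fun Y => by fun_prop).contDiffOn, fun _ _ => rfl⟩,
    fun _ _ => ⟨A, B, rfl⟩⟩

/-- In terms of the lifted function, `X = M Nᵀ` is a nondegenerate critical point if the first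
derivative vanishes at `z = (M, N)` and the kernel of the second one consists of the vertical
vectors. -/
structure IsLiftedNondegenerate (f : Mat m n → ℝ) (z : Pair m n p) : Prop where
  fderiv_eq_zero : fderiv ℝ (lifted f) z = 0
  hess_eq_zero : ∀ u v, dproj z v = 0 → fderiv ℝ (fderiv ℝ (lifted f)) z u v = 0
  dproj_eq_zero : ∀ u, fderiv ℝ (fderiv ℝ (lifted f)) z u = 0 → dproj z u = 0

variable {f : Mat m n → ℝ} {z : Pair m n p} {g : Mat m n → Mat m n → Mat m n → ℝ}
  {X : Mat m n} {G : Mat m n → Mat m n}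

theorem IsRiemannianMetric.zero_left (hg : IsRiemannianMetric p g) (hX : X ∈ Mp m n p)
    {ξ : Mat m n} (hξ : ξ ∈ tangentSpace X) : g X 0 ξ = 0 := by
  simpa using hg.smul_left X hX 0 0 (zero_mem _) ξ hξ

theorem IsRiemannianMetric.zero_right (hg : IsRiemannianMetric p g) (hX : X ∈ Mp m n p)
    {ξ : Mat m n} (hξ : ξ ∈ tangentSpace X) : g X ξ 0 = 0 := by
  rw [hg.symm X hX ξ hξ 0 (zero_mem _), hg.zero_left hX hξ]

theorem IsRiemannianMetric.eq_zero_of_self (hg : IsRiemannianMetric p g) (hX : X ∈ Mp m n p)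
    {ξ : Mat m n} (hξ : ξ ∈ tangentSpace X) (h : g X ξ ξ = 0) : ξ = 0 :=
  by_contra fun hne => (hg.pos X hX ξ hξ hne).ne' h

theorem IsGradient.fderiv_lifted (hf : SmoothOnMp p f) (hG : IsGradient p g f G)
    (hz : z ∈ Rp m n p) (v : Pair m n p) :
    fderiv ℝ (lifted f) z v = g (proj z) (G (proj z)) (dproj z v) := by
  rw [hG.2 _ (proj_mem hz) _ (dproj_mem hz v)]
  exact hf.fderiv_comp_proj hz v

theorem fderiv_lifted_eq_zero (hf : SmoothOnMp p f) (hg : IsRiemannianMetric p g)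
    (hG : IsGradient p g f G) (hz : z ∈ Rp m n p) (hG0 : G (proj z) = 0) :
    fderiv ℝ (lifted f) z = 0 :=
  ContinuousLinearMap.ext fun v => by
    rw [hG.fderiv_lifted hf hz, hG0, hg.zero_left (proj_mem hz) (dproj_mem hz v)]
    rfl

theorem fderiv_fderiv_apply_of_fderiv_eq_zero {E F : Type*} [NormedAddCommGroup E]
    [NormedSpace ℝ E] [FiniteDimensional ℝ E] [NormedAddCommGroup F] [NormedSpace ℝ F] {φ : E → F}
    {x : E} (hφ : ContDiffAt ℝ 2 φ x) (h0 : fderiv ℝ φ x = 0) (L : E →ₗ[ℝ] E) (u : E) :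
    fderiv ℝ (fun y => fderiv ℝ φ y (L y)) x u = fderiv ℝ (fderiv ℝ φ) x u (L x) := by
  have hd : DifferentiableAt ℝ (fderiv ℝ φ) x :=
    (hφ.fderiv_right (m := 1) (by norm_num)).differentiableAt one_ne_zero
  have hprod := hd.hasFDerivAt.clm_apply (LinearMap.toContinuousLinearMap L).hasFDerivAt
  refine (DFunLike.congr_fun hprod.fderiv u).trans ?_
  simp [h0]

theorem fderiv_fderiv_lifted_apply {del : (Mat m n → Mat m n) → (Mat m n → Mat m n) → Mat m n →
    Mat m n} (hf : SmoothOnMp p f) (hg : IsRiemannianMetric p g) (hG : IsGradient p g f G)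
    (hdel : IsLeviCivita p g del) (hz : z ∈ Rp m n p) (hG0 : G (proj z) = 0)
    {χ : Mat m n → Mat m n} (hχ : IsVectorField p χ) {u : Pair m n p}
    (hu : dproj z u = χ (proj z)) (v : Pair m n p) :
    fderiv ℝ (fderiv ℝ (lifted f)) z u v = g (proj z) (del χ G (proj z)) (dproj z v) := by
  obtain ⟨A, B, rfl⟩ := exists_linLift_eq hz v
  have hζ := isVectorField_lin (p := p) A B
  have hlift : (fun w : Pair m n p => g (proj w) (G (proj w)) (A * proj w + proj w * B)) =ᶠ[𝓝 z]
      fun w => fderiv ℝ (lifted f) w (linLift A B w) := by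
    filter_upwards [isOpen_Rp.mem_nhds hz] with w hw
    rw [hG.fderiv_lifted hf hw, dproj_linLift]
  have hcompat := hdel.metric_compatible χ G _ hχ hG.1 hζ _ (proj_mem hz)
  rw [hG0, hg.zero_left (proj_mem hz) ((hdel.isVectorField _ _ hχ hζ).2 _ (proj_mem hz)), add_zero,
    ← hu, ← (hg.smooth _ _ hG.1 hζ).fderiv_comp_proj hz, hlift.fderiv_eq] at hcompat
  rw [dproj_linLift, ← hcompat]
  exact (fderiv_fderiv_apply_of_fderiv_eq_zero
    ((hf.contDiffAt_comp_proj hz).of_le (by norm_cast))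
    (fderiv_lifted_eq_zero hf hg hG hz hG0) (linLift A B) u).symm

theorem IsNondegenerateCriticalPoint.isLiftedNondegenerate (hf : SmoothOnMp p f)
    (hg : IsRiemannianMetric p g) (hz : z ∈ Rp m n p)
    (h : IsNondegenerateCriticalPoint p g f (proj z)) : IsLiftedNondegenerate f z := by
  obtain ⟨hX, G, del, hG, hdel, hG0, hess, hhess⟩ := h
  have hkey : ∀ u v, fderiv ℝ (fderiv ℝ (lifted f)) z u v
      = g (proj z) (hess ⟨dproj z u, dproj_mem hz u⟩) (dproj z v) := fun u v => by
    obtain ⟨A, B, hAB⟩ := dproj_mem hz u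
    have hχ := isVectorField_lin (p := p) A B
    rw [fderiv_fderiv_lifted_apply hf hg hG hdel hz hG0 hχ hAB,
      hhess ⟨dproj z u, dproj_mem hz u⟩ _ hχ hAB.symm]
  refine ⟨fderiv_lifted_eq_zero hf hg hG hz hG0, fun u v hv => ?_, fun u hu => ?_⟩
  · rw [hkey, hv, hg.zero_right hX (Subtype.mem _)]
  · obtain ⟨v, hv⟩ := exists_dproj_eq hz (hess ⟨dproj z u, dproj_mem hz u⟩).2
    have hself : g (proj z) (hess ⟨dproj z u, dproj_mem hz u⟩) (dproj z v) = 0 := by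
      rw [← hkey, hu]
      rfl
    rw [hv] at hself
    have hzero : hess ⟨dproj z u, dproj_mem hz u⟩ = 0 :=
      Subtype.ext (hg.eq_zero_of_self hX (Subtype.mem _) hself)
    exact congr_arg Subtype.val (hess.map_eq_zero_iff.1 hzero)

end Hessian

/-! ### The Euclidean gradient of the lifted function -/

section Gradient

theorem linearMap_apply_eq_trace {a b R : Type*} [Fintype a] [Fintype b] [DecidableEq a]
    [DecidableEq b] [CommSemiring R] (l : Matrix a b R →ₗ[R] R) (A : Matrix a b R) :
    l A = ((Matrix.of fun i j => l (Matrix.single i j 1))ᵀ * A).trace := by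
  conv_lhs => rw [Matrix.matrix_eq_sum_single A]
  simp only [map_sum, Matrix.trace, Matrix.diag_apply, Matrix.mul_apply, Matrix.transpose_apply,
    Matrix.of_apply]
  rw [Finset.sum_comm]
  refine Finset.sum_congr rfl fun j _ => Finset.sum_congr rfl fun i _ => ?_
  rw [← mul_one (A i j), ← smul_eq_mul, ← Matrix.smul_single, map_smul, smul_eq_mul, mul_comm,
    smul_eq_mul, mul_one]

variable {m n p : ℕ} {f : Mat m n → ℝ} {z : Pair m n p}

theorem oMetric_ext {a b : Pair m n p} (h : ∀ v, oMetric a v = oMetric b v) : a = b := by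
  refine Prod.ext (Matrix.transpose_injective (Matrix.ext_iff_trace_mul_right.2 fun x => ?_))
    (Matrix.transpose_injective (Matrix.ext_iff_trace_mul_right.2 fun x => ?_))
  · simpa [oMetric] using h (x, 0)
  · simpa [oMetric] using h (0, x)

/-- The pair that represents a linear functional in the Euclidean metric. -/
def riesz : (Pair m n p →L[ℝ] ℝ) →ₗ[ℝ] Pair m n p where
  toFun φ := (Matrix.of fun i j => φ (Matrix.single i j 1, 0),
    Matrix.of fun i j => φ (0, Matrix.single i j 1))
  map_add' _ _ := rfl
  map_smul' _ _ := rfl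

theorem oMetric_riesz (φ : Pair m n p →L[ℝ] ℝ) (v : Pair m n p) : oMetric (riesz φ) v = φ v := by
  have hfst := linearMap_apply_eq_trace (φ.toLinearMap ∘ₗ LinearMap.inl ℝ (Mat m p) (Mat n p)) v.1
  have hsnd := linearMap_apply_eq_trace (φ.toLinearMap ∘ₗ LinearMap.inr ℝ (Mat m p) (Mat n p)) v.2
  have hv : φ v = φ (v.1, 0) + φ (0, v.2) := by rw [← map_add]; simp
  rw [hv, oMetric, Matrix.trace_add]
  exact (congr_arg₂ (· + ·) hfst hsnd).symm

/-- The Euclidean gradient of the lifted function. -/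
noncomputable def egrad (f : Mat m n → ℝ) (z : Pair m n p) : Pair m n p :=
  riesz (fderiv ℝ (lifted f) z)

theorem contDiffAt_egrad {k : ℕ} (hf : SmoothOnMp p f) (hz : z ∈ Rp m n p) :
    ContDiffAt ℝ k (egrad f : Pair m n p → Pair m n p) z :=
  contDiffAt_linearMap_comp riesz
    ((hf.contDiffAt_comp_proj hz).fderiv_right (by norm_cast; exact le_top))

theorem fderiv_linearMap_comp {E V W : Type*} [NormedAddCommGroup E] [NormedSpace ℝ E]
    [NormedAddCommGroup V] [NormedSpace ℝ V] [FiniteDimensional ℝ V] [NormedAddCommGroup W]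
    [NormedSpace ℝ W] (L : V →ₗ[ℝ] W) {φ : E → V} {x : E} (hφ : DifferentiableAt ℝ φ x) (v : E) :
    fderiv ℝ (fun y => L (φ y)) x v = L (fderiv ℝ φ x v) :=
  DFunLike.congr_fun
    ((LinearMap.toContinuousLinearMap L).hasFDerivAt.comp x hφ.hasFDerivAt).fderiv v

theorem fderiv_egrad (hf : SmoothOnMp p f) (hz : z ∈ Rp m n p) (u : Pair m n p) :
    fderiv ℝ (egrad f) z u = riesz (fderiv ℝ (fderiv ℝ (lifted f)) z u) :=
  fderiv_linearMap_comp riesz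
    (((hf.contDiffAt_comp_proj hz).fderiv_right (m := 1) (by norm_cast)).differentiableAt
      one_ne_zero) u

theorem fderiv_linearMap_apply_of_eq_zero {E K F : Type*} [NormedAddCommGroup E] [NormedSpace ℝ E]
    [NormedAddCommGroup K] [NormedSpace ℝ K] [FiniteDimensional ℝ K] [NormedAddCommGroup F]
    [NormedSpace ℝ F] {P : E → K →ₗ[ℝ] F} {e : E → K} {z : E}
    (hP : ∀ y, ContDiffAt ℝ 1 (fun x => P x y) z) (he : DifferentiableAt ℝ e z) (h0 : e z = 0)
    (v : E) : fderiv ℝ (fun w => P w (e w)) z v = P z (fderiv ℝ e z v) := by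
  have hP' : ContDiffAt ℝ 1 (fun w => LinearMap.toContinuousLinearMap (P w)) z :=
    contDiffAt_clm_of_apply hP
  have hprod := (hP'.differentiableAt one_ne_zero).hasFDerivAt.clm_apply he.hasFDerivAt
  refine (DFunLike.congr_fun hprod.fderiv v).trans ?_
  simp [h0]

end Gradient

/-! ### Iteration (A): full-rank factors -/

section SymPart

variable {p : ℕ}

theorem isLinearMap_symPart : IsLinearMap ℝ (symPart : Mat p p → Mat p p) where
  map_add A B := by simp only [symPart, Matrix.transpose_add, ← smul_add, add_add_add_comm]
  map_smul c A := by simp only [symPart, Matrix.transpose_smul, ← smul_add, smul_comm c]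

@[fun_prop]
theorem contDiffAt_symPart {E : Type*} [NormedAddCommGroup E] [NormedSpace ℝ E]
    {k : WithTop ℕ∞} {x : E} {f : E → Mat p p} (hf : ContDiffAt ℝ k f x) :
    ContDiffAt ℝ k (fun y => symPart (f y)) x :=
  contDiffAt_linearMap_comp (isLinearMap_symPart.mk' _) hf

end SymPart

section FullRank

variable {m n p : ℕ} {f : Mat m n → ℝ} {z : Pair m n p}

theorem pinv_mul_transpose_pinv {a b : ℕ} {M : Mat a b} (hM : M.rank = b) :
    pinv M * (pinv M)ᵀ = (Mᵀ * M)⁻¹ := by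
  nth_rw 1 [pinv]
  rw [Matrix.mul_assoc, transpose_mul_transpose_pinv hM, Matrix.mul_one]

theorem trace_gram_inv_mul {a b c : ℕ} {M : Mat a b} (hM : M.rank = b) (x : Mat c b) :
    ((Mᵀ * M)⁻¹ * xᵀ * x).trace = ‖x * pinv M‖ ^ 2 := by
  rw [sq_norm_eq_trace, ← pinv_mul_transpose_pinv hM, Matrix.transpose_mul, Matrix.mul_assoc,
    Matrix.mul_assoc, Matrix.trace_mul_comm]
  simp only [Matrix.mul_assoc]

theorem eq_zero_of_mul_pinv_eq_zero {a b c : ℕ} {M : Mat a b} (hM : M.rank = b) {x : Mat c b}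
    (hx : x * pinv M = 0) : x = 0 := by
  rw [← Matrix.mul_one x, ← pinv_mul hM, ← Matrix.mul_assoc, hx, Matrix.zero_mul]

theorem eq_zero_of_metric_self (hz : z ∈ Rp m n p) {v : Pair m n p} (h : metric z v v = 0) :
    v = 0 := by
  rw [metric, Matrix.trace_add, trace_gram_inv_mul hz.1, trace_gram_inv_mul hz.2,
    add_eq_zero_iff_of_nonneg (sq_nonneg _) (sq_nonneg _), sq_eq_zero_iff, sq_eq_zero_iff,
    norm_eq_zero, norm_eq_zero] at h
  exact Prod.ext (eq_zero_of_mul_pinv_eq_zero hz.1 h.1) (eq_zero_of_mul_pinv_eq_zero hz.2 h.2)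

/-- Multiplication of both factors by their Gram matrices, which turns Euclidean gradients into
gradients for `metric`. -/
def gramMul (z : Pair m n p) : Pair m n p →ₗ[ℝ] Pair m n p where
  toFun e := (e.1 * (z.1ᵀ * z.1), e.2 * (z.2ᵀ * z.2))
  map_add' _ _ := by simp only [Prod.fst_add, Prod.snd_add, Matrix.add_mul, Prod.mk_add_mk]
  map_smul' _ _ := by simp

theorem gram_inv_mul_transpose_mul_gram {a b c : ℕ} {M : Mat a b} (hM : M.rank = b)
    (x : Mat c b) : (Mᵀ * M)⁻¹ * (x * (Mᵀ * M))ᵀ = xᵀ := by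
  rw [Matrix.transpose_mul, Matrix.transpose_mul, Matrix.transpose_transpose,
    Matrix.nonsing_inv_mul_cancel_left _ _ (isUnit_gram hM)]

theorem metric_gramMul (hz : z ∈ Rp m n p) (e v : Pair m n p) :
    metric z (gramMul z e) v = oMetric e v := by
  simp only [metric, oMetric, gramMul, LinearMap.coe_mk, AddHom.coe_mk,
    gram_inv_mul_transpose_mul_gram hz.1, gram_inv_mul_transpose_mul_gram hz.2]

/-- The adjoint of `vert z` with respect to `metric z` and the trace pairing. -/
noncomputable def horDefect (z : Pair m n p) : Pair m n p →ₗ[ℝ] Mat p p where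
  toFun u := (z.1ᵀ * z.1)⁻¹ * u.1ᵀ * z.1 - z.2ᵀ * u.2 * (z.2ᵀ * z.2)⁻¹
  map_add' u v := by
    simp only [Prod.fst_add, Prod.snd_add, Matrix.transpose_add, Matrix.add_mul, Matrix.mul_add]
    abel
  map_smul' c u := by simp [smul_sub]

theorem metric_vert (z u : Pair m n p) (R : Mat p p) :
    metric z u (vert z R) = (horDefect z u * R).trace := by
  have hsnd : ((z.2ᵀ * z.2)⁻¹ * u.2ᵀ * (z.2 * Rᵀ)).trace
      = (z.2ᵀ * u.2 * (z.2ᵀ * z.2)⁻¹ * R).trace := by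
    rw [← Matrix.trace_transpose]
    simp only [Matrix.transpose_mul, Matrix.transpose_transpose, Matrix.transpose_nonsing_inv]
    rw [Matrix.mul_assoc, Matrix.trace_mul_comm]
    simp only [Matrix.mul_assoc]
  rw [metric, vert_apply, Matrix.trace_add, Matrix.mul_neg, Matrix.trace_neg, hsnd,
    ← sub_eq_add_neg, ← Matrix.mul_assoc, ← Matrix.trace_sub, ← Matrix.sub_mul]
  rfl

theorem mem_horizontal {u : Pair m n p} : u ∈ horizontal z ↔ horDefect z u = 0 := by
  refine ⟨fun h => Matrix.ext_iff_trace_mul_right.2 fun R => ?_, fun h v hv => ?_⟩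
  · rw [← metric_vert, h (vert z R) ⟨R, rfl⟩, Matrix.zero_mul, Matrix.trace_zero]
  · obtain ⟨R, rfl⟩ := hv
    rw [← vert_apply, metric_vert, h, Matrix.zero_mul, Matrix.trace_zero]

theorem contDiffAt_horDefect {k : WithTop ℕ∞} (hz : z ∈ Rp m n p) (u : Pair m n p) :
    ContDiffAt ℝ k (fun w => horDefect w u) z := by
  have hM : ContDiffAt ℝ k (fun w : Pair m n p => (w.1ᵀ * w.1)⁻¹) z :=
    contDiffAt_matrix_inv (by fun_prop) (isUnit_gram hz.1)
  have hN : ContDiffAt ℝ k (fun w : Pair m n p => (w.2ᵀ * w.2)⁻¹) z :=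
    contDiffAt_matrix_inv (by fun_prop) (isUnit_gram hz.2)
  simp only [horDefect, LinearMap.coe_mk, AddHom.coe_mk]
  fun_prop

theorem contDiffAt_gramMul {k : WithTop ℕ∞} {g : Pair m n p → Pair m n p}
    (hg : ContDiffAt ℝ k g z) : ContDiffAt ℝ k (fun w => gramMul w (g w)) z := by
  simp only [gramMul, LinearMap.coe_mk, AddHom.coe_mk]
  fun_prop

theorem contDiffAt_gradLifted {k : ℕ} (hf : SmoothOnMp p f) (hz : z ∈ Rp m n p) :
    ContDiffAt ℝ k (gradLifted f : Pair m n p → Pair m n p) z :=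
  contDiffAt_gramMul (contDiffAt_egrad hf hz)

theorem oMetric_egrad_eq_zero_of_dproj (hf : SmoothOnMp p f) (hz : z ∈ Rp m n p)
    {v : Pair m n p} (hv : dproj z v = 0) : oMetric (egrad f z) v = 0 := by
  rw [egrad, oMetric_riesz]
  exact (hf.fderiv_comp_proj hz v).trans (by rw [hv, map_zero])

theorem gradLifted_mem_horizontal (hf : SmoothOnMp p f) (hz : z ∈ Rp m n p) :
    gradLifted f z ∈ horizontal z := by
  rintro _ ⟨R, rfl⟩
  exact (metric_gramMul hz (egrad f z) _).trans
    (oMetric_egrad_eq_zero_of_dproj hf hz (dproj_vert z R))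

theorem IsLiftedNondegenerate.egrad_eq_zero (h : IsLiftedNondegenerate f z) : egrad f z = 0 := by
  rw [egrad, h.fderiv_eq_zero, map_zero]

theorem IsLiftedNondegenerate.gradLifted_eq_zero (h : IsLiftedNondegenerate f z) :
    gradLifted f z = 0 :=
  (congr_arg (gramMul z) h.egrad_eq_zero).trans (map_zero _)

theorem IsLiftedNondegenerate.fderiv_gradLifted (h : IsLiftedNondegenerate f z)
    (hf : SmoothOnMp p f) (hz : z ∈ Rp m n p) (u : Pair m n p) :
    fderiv ℝ (gradLifted f) z u = gramMul z (fderiv ℝ (egrad f) z u) :=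
  fderiv_linearMap_apply_of_eq_zero (P := gramMul) (fun _ => contDiffAt_gramMul contDiffAt_const)
    ((contDiffAt_egrad (k := 1) hf hz).differentiableAt (by simp)) h.egrad_eq_zero u

theorem IsLiftedNondegenerate.metric_fderiv_gradLifted (h : IsLiftedNondegenerate f z)
    (hf : SmoothOnMp p f) (hz : z ∈ Rp m n p) (u v : Pair m n p) :
    metric z (fderiv ℝ (gradLifted f) z u) v = fderiv ℝ (fderiv ℝ (lifted f)) z u v := by
  rw [h.fderiv_gradLifted hf hz, metric_gramMul hz, fderiv_egrad hf hz, oMetric_riesz]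

theorem connFactor_add {a : ℕ} (M x x' y d d' : Mat a p) :
    connFactor M (x + x') y (d + d') = connFactor M x y d + connFactor M x' y d' := by
  simp only [connFactor, Matrix.transpose_add, Matrix.add_mul, isLinearMap_symPart.map_add,
    Matrix.mul_add]
  abel

theorem connFactor_smul {a : ℕ} (c : ℝ) (M x y d : Mat a p) :
    connFactor M (c • x) y (c • d) = c • connFactor M x y d := by
  simp only [connFactor, Matrix.transpose_smul, Matrix.smul_mul, isLinearMap_symPart.map_smul,
    Matrix.mul_smul, smul_add, smul_sub]

theorem connFactor_zero {a : ℕ} (M x d : Mat a p) : connFactor M x 0 d = d := by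
  simp [connFactor, isLinearMap_symPart.map_zero]

theorem contDiffAt_connFactor {a : ℕ} {E : Type*} [NormedAddCommGroup E] [NormedSpace ℝ E]
    {k : WithTop ℕ∞} {w : E} {M x y d : E → Mat a p} (hM : ContDiffAt ℝ k M w)
    (hx : ContDiffAt ℝ k x w) (hy : ContDiffAt ℝ k y w) (hd : ContDiffAt ℝ k d w)
    (hrank : (M w).rank = p) :
    ContDiffAt ℝ k (fun q => connFactor (M q) (x q) (y q) (d q)) w := by
  have hG : ContDiffAt ℝ k (fun q => ((M q)ᵀ * M q)⁻¹) w :=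
    contDiffAt_matrix_inv (by fun_prop) (isUnit_gram hrank)
  simp only [connFactor]
  fun_prop

/-- The covariant derivative of the field `Y` at `z`, as a linear map of the direction. -/
noncomputable def connLinear (Y : Pair m n p → Pair m n p) (z : Pair m n p) :
    Pair m n p →ₗ[ℝ] Pair m n p where
  toFun := conn Y z
  map_add' u v := by
    simp only [conn, map_add, Prod.fst_add, Prod.snd_add, connFactor_add, Prod.mk_add_mk]
  map_smul' c u := by
    simp only [conn, map_smul, Prod.smul_fst, Prod.smul_snd, connFactor_smul, Prod.smul_mk,
      RingHom.id_apply]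

theorem connLinear_of_eq_zero {Y : Pair m n p → Pair m n p} (hY : Y z = 0) :
    connLinear Y z = (fderiv ℝ Y z).toLinearMap := by
  refine LinearMap.ext fun u => ?_
  change conn Y z u = fderiv ℝ Y z u
  simp only [conn, hY, Prod.fst_zero, Prod.snd_zero, connFactor_zero]

theorem contDiffAt_connLinear {k : ℕ} {Y : Pair m n p → Pair m n p}
    (hY : ContDiffAt ℝ (k + 1 : ℕ) Y z) (hz : z ∈ Rp m n p) (u : Pair m n p) :
    ContDiffAt ℝ k (fun w => connLinear Y w u) z := by
  have hd : ContDiffAt ℝ k (fun w => fderiv ℝ Y w u) z :=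
    (hY.fderiv_right (m := k) (by norm_cast)).clm_apply contDiffAt_const
  have hY' : ContDiffAt ℝ k Y z := hY.of_le (by norm_cast; omega)
  exact (contDiffAt_connFactor contDiffAt_fst contDiffAt_const hY'.fst hd.fst hz.1).prodMk
    (contDiffAt_connFactor contDiffAt_snd contDiffAt_const hY'.snd hd.snd hz.2)

theorem isNewtonVector_iff (hf : SmoothOnMp p f) (hz : z ∈ Rp m n p) (u : Pair m n p) :
    IsNewtonVector horizontal vertical conn (gradLifted f) z u ↔
      horDefect z u = 0 ∧ ∃ R, connLinear (gradLifted f) z u + vert z R = -gradLifted f z := by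
  have hY : -gradLifted f z ∈ horizontal z := by
    rw [mem_horizontal, map_neg, mem_horizontal.1 (gradLifted_mem_horizontal hf hz), neg_zero]
  rw [IsNewtonVector, IsHorizontalProj, mem_horizontal]
  refine and_congr_right fun _ => ⟨?_, ?_⟩
  · rintro ⟨-, R, hR⟩
    exact ⟨-R, by rw [map_neg, vert_apply, ← hR, ← sub_eq_add_neg]; exact sub_sub_cancel _ _⟩
  · rintro ⟨R, hR⟩
    refine ⟨hY, -R, ?_⟩
    rw [← vert_apply, map_neg, ← hR]
    exact sub_add_cancel_left _ _

theorem IsLiftedNondegenerate.isNondegenerateBordering (h : IsLiftedNondegenerate f z)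
    (hf : SmoothOnMp p f) (hz : z ∈ Rp m n p) :
    IsNondegenerateBordering (connLinear (gradLifted f) z) (vert z) (horDefect z) (dproj z) := by
  rw [connLinear_of_eq_zero h.gradLifted_eq_zero]
  refine ⟨?_, vert_injective hz.1, fun u hu => ?_, ?_⟩
  · refine Submodule.disjoint_def.2 ?_
    rintro _ ⟨u, rfl⟩ ⟨R, hR⟩
    refine eq_zero_of_metric_self hz ?_
    nth_rw 2 [← hR]
    exact (h.metric_fderiv_gradLifted hf hz _ _).trans (h.hess_eq_zero _ _ (dproj_vert z R))
  · refine h.dproj_eq_zero u (ContinuousLinearMap.ext fun v => ?_)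
    rw [← h.metric_fderiv_gradLifted hf hz, show fderiv ℝ (gradLifted f) z u = 0 from hu]
    simp [metric]
  · refine Submodule.disjoint_def.2 fun u hC hπ => ?_
    obtain ⟨R, rfl⟩ := exists_vert_eq hz hπ
    exact eq_zero_of_metric_self hz (mem_horizontal.2 hC _ ⟨R, rfl⟩)

theorem IsLiftedNondegenerate.exists_isNewtonField (h : IsLiftedNondegenerate f z)
    (hf : SmoothOnMp p f) (hz : z ∈ Rp m n p) :
    ∃ x, IsNewtonField (Rp m n p) (IsNewtonVector horizontal vertical conn (gradLifted f))
      (dproj z) z x := by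
  refine FixedRank.exists_isNewtonField (contDiffAt_connLinear (contDiffAt_gradLifted hf hz) hz)
    (fun R => ?_) (contDiffAt_horDefect hz) (contDiffAt_gradLifted hf hz) h.gradLifted_eq_zero
    (fun u => by rw [connLinear_of_eq_zero h.gradLifted_eq_zero]; rfl)
    (h.isNondegenerateBordering hf hz) ?_
  · simp only [vert_apply]
    fun_prop
  · filter_upwards [self_mem_nhdsWithin] with w hw u using isNewtonVector_iff hf hw u

end FullRank

/-! ### Iteration (B): orthonormal first factor -/

section SkewPart

variable {p : ℕ}

theorem symPart_of_transpose_eq {A : Mat p p} (h : Aᵀ = A) : symPart A = A := by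
  rw [symPart, h, ← two_smul ℝ A, smul_smul]
  norm_num

theorem symPart_symPart (A : Mat p p) : symPart (symPart A) = symPart A :=
  symPart_of_transpose_eq (by simp [symPart, add_comm])

theorem symPart_eq_zero_iff {A : Mat p p} : symPart A = 0 ↔ A = -Aᵀ := by
  rw [symPart, smul_eq_zero, or_iff_right (by norm_num), eq_neg_iff_add_eq_zero]

theorem trace_transpose_symPart_mul (A B : Mat p p) :
    ((symPart A)ᵀ * B).trace = (Aᵀ * symPart B).trace := by
  have hcross : (A * B).trace = (Aᵀ * Bᵀ).trace := by
    rw [← Matrix.transpose_mul, Matrix.trace_transpose, Matrix.trace_mul_comm]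
  simp only [symPart, Matrix.transpose_smul, Matrix.transpose_add, Matrix.transpose_transpose,
    Matrix.smul_mul, Matrix.mul_smul, Matrix.add_mul, Matrix.mul_add, Matrix.trace_smul,
    Matrix.trace_add, hcross]

/-- The skew-symmetric part of a square matrix. -/
noncomputable def skewPart : Mat p p →ₗ[ℝ] Mat p p := LinearMap.id - isLinearMap_symPart.mk' symPart

theorem skewPart_apply (A : Mat p p) : skewPart A = A - symPart A := rfl

theorem symPart_skewPart (A : Mat p p) : symPart (skewPart A) = 0 := by
  rw [skewPart_apply, isLinearMap_symPart.map_sub, symPart_symPart, sub_self]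

theorem trace_transpose_skewPart_mul (A B : Mat p p) :
    ((skewPart A)ᵀ * B).trace = (Aᵀ * skewPart B).trace := by
  rw [skewPart_apply, skewPart_apply, Matrix.transpose_sub, Matrix.sub_mul, Matrix.mul_sub,
    Matrix.trace_sub, Matrix.trace_sub, trace_transpose_symPart_mul]

end SkewPart

section Orthonormal

variable {m n p : ℕ} {f : Mat m n → ℝ} {z : Pair m n p}

theorem eq_zero_of_oMetric_self {v : Pair m n p} (h : oMetric v v = 0) : v = 0 := by
  rw [oMetric, Matrix.trace_add, ← sq_norm_eq_trace, ← sq_norm_eq_trace,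
    add_eq_zero_iff_of_nonneg (sq_nonneg _) (sq_nonneg _), sq_eq_zero_iff, sq_eq_zero_iff,
    norm_eq_zero, norm_eq_zero] at h
  exact Prod.ext h.1 h.2

theorem mem_oTangent {u : Pair m n p} : u ∈ oTangent z ↔ symPart (z.1ᵀ * u.1) = 0 := by
  rw [symPart_eq_zero_iff, eq_neg_iff_add_eq_zero, Matrix.transpose_mul, Matrix.transpose_transpose]
  rfl

theorem vert_mem_oTangent_iff (hz : z ∈ SRp m n p) {R : Mat p p} :
    vert z R ∈ oTangent z ↔ symPart R = 0 := by
  rw [mem_oTangent, vert_apply, ← Matrix.mul_assoc, hz.1, Matrix.one_mul]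

/-- The image of `oFrame z` is the orthogonal complement of `oHorizontal z` in the whole space of
pairs: skew-symmetric matrices `Q` give the vertical vectors `(M Q, N Q)`, symmetric ones the
normal vectors `(M Q, 0)` of `SRp m n p`. -/
noncomputable def oFrame (z : Pair m n p) : Mat p p →ₗ[ℝ] Pair m n p where
  toFun Q := (z.1 * Q, z.2 * skewPart Q)
  map_add' _ _ := by simp only [map_add, Matrix.mul_add, Prod.mk_add_mk]
  map_smul' _ _ := by simp only [map_smul, Matrix.mul_smul, Prod.smul_mk, RingHom.id_apply]

theorem oFrame_apply (z : Pair m n p) (Q : Mat p p) :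
    oFrame z Q = (z.1 * Q, z.2 * skewPart Q) := rfl

theorem oFrame_of_symPart_eq_zero {W : Mat p p} (hW : symPart W = 0) : oFrame z W = vert z W := by
  rw [oFrame_apply, skewPart_apply, hW, sub_zero, vert_apply, ← Matrix.mul_neg,
    ← symPart_eq_zero_iff.1 hW]

theorem oFrame_injective (hz : z.1.rank = p) : Function.Injective (oFrame z) := fun _ _ h =>
  mul_left_cancel_of_rank_eq hz (congr_arg Prod.fst h)

theorem mem_oVertical {v : Pair m n p} : v ∈ oVertical z ↔ ∃ W, symPart W = 0 ∧ oFrame z W = v := by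
  refine exists_congr fun W => ?_
  rw [← symPart_eq_zero_iff]
  refine and_congr_right fun hW => ?_
  rw [oFrame_apply, skewPart_apply, hW, sub_zero, eq_comm]

theorem vert_mem_oVertical {W : Mat p p} (hW : symPart W = 0) : vert z W ∈ oVertical z :=
  mem_oVertical.2 ⟨W, hW, oFrame_of_symPart_eq_zero hW⟩

theorem symPart_eq_zero_of_oFrame_mem (hz : z ∈ SRp m n p) {Q : Mat p p}
    (h : oFrame z Q ∈ oTangent z) : symPart Q = 0 := by
  rwa [mem_oTangent, oFrame_apply, ← Matrix.mul_assoc, hz.1, Matrix.one_mul] at h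

/-- The adjoint of `oFrame z` for the Euclidean metric. -/
noncomputable def oDefect (z : Pair m n p) : Pair m n p →ₗ[ℝ] Mat p p where
  toFun u := z.1ᵀ * u.1 + skewPart (z.2ᵀ * u.2)
  map_add' u v := by
    simp only [Prod.fst_add, Prod.snd_add, Matrix.mul_add, map_add, add_add_add_comm]
  map_smul' c u := by
    simp only [Prod.smul_fst, Prod.smul_snd, Matrix.mul_smul, map_smul, smul_add,
      RingHom.id_apply]

theorem oDefect_apply (z u : Pair m n p) :
    oDefect z u = z.1ᵀ * u.1 + skewPart (z.2ᵀ * u.2) := rfl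

theorem oMetric_oFrame (z u : Pair m n p) (Q : Mat p p) :
    oMetric u (oFrame z Q) = ((oDefect z u)ᵀ * Q).trace := by
  rw [oDefect_apply, Matrix.transpose_add, Matrix.add_mul, Matrix.trace_add,
    trace_transpose_skewPart_mul, oMetric, oFrame_apply, Matrix.trace_add]
  simp only [Matrix.transpose_mul, Matrix.transpose_transpose, Matrix.mul_assoc]

theorem symPart_oDefect (z u : Pair m n p) : symPart (oDefect z u) = symPart (z.1ᵀ * u.1) := by
  rw [oDefect_apply, isLinearMap_symPart.map_add, symPart_skewPart, add_zero]

theorem mem_oHorizontal {u : Pair m n p} : u ∈ oHorizontal z ↔ oDefect z u = 0 := by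
  refine ⟨fun ⟨ht, hv⟩ => ?_, fun h => ⟨?_, fun v hv => ?_⟩⟩
  · rw [mem_oTangent, ← symPart_oDefect] at ht
    have horth := hv _ (mem_oVertical.2 ⟨_, ht, rfl⟩)
    rwa [oMetric_oFrame, ← sq_norm_eq_trace, sq_eq_zero_iff, norm_eq_zero] at horth
  · rw [mem_oTangent, ← symPart_oDefect, h, isLinearMap_symPart.map_zero]
  · obtain ⟨W, -, rfl⟩ := mem_oVertical.1 hv
    rw [oMetric_oFrame, h, Matrix.transpose_zero, Matrix.zero_mul, Matrix.trace_zero]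

theorem oTangentProj_mem (hz : z ∈ SRp m n p) (w : Pair m n p) : oTangentProj z w ∈ oTangent z := by
  rw [mem_oTangent, oTangentProj, Matrix.mul_sub, ← Matrix.mul_assoc, hz.1, Matrix.one_mul,
    isLinearMap_symPart.map_sub, symPart_symPart, sub_self]

theorem oTangentProj_of_mem {w : Pair m n p} (hw : w ∈ oTangent z) : oTangentProj z w = w := by
  rw [oTangentProj, mem_oTangent.1 hw, Matrix.mul_zero, sub_zero]

theorem oMetric_oTangentProj (w : Pair m n p) {t : Pair m n p} (ht : t ∈ oTangent z) :
    oMetric (oTangentProj z w) t = oMetric w t := by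
  have hnormal : ((z.1 * symPart (z.1ᵀ * w.1))ᵀ * t.1).trace = 0 := by
    rw [Matrix.transpose_mul, Matrix.mul_assoc, trace_transpose_symPart_mul, mem_oTangent.1 ht,
      Matrix.mul_zero, Matrix.trace_zero]
  simp only [oMetric, oTangentProj, Matrix.transpose_sub, Matrix.sub_mul, Matrix.trace_add,
    Matrix.trace_sub, hnormal, sub_zero]

/-- `oTangentProj z` as a linear map. -/
noncomputable def oTangentProjLinear (z : Pair m n p) : Pair m n p →ₗ[ℝ] Pair m n p where
  toFun := oTangentProj z
  map_add' u v := by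
    simp only [oTangentProj, Prod.fst_add, Prod.snd_add, Matrix.mul_add,
      isLinearMap_symPart.map_add, Prod.mk_add_mk, add_sub_add_comm]
  map_smul' c u := by
    simp only [oTangentProj, Prod.smul_fst, Prod.smul_snd, Matrix.mul_smul,
      isLinearMap_symPart.map_smul, Prod.smul_mk, smul_sub, RingHom.id_apply]

theorem contDiffAt_oTangentProjLinear {k : WithTop ℕ∞} {g : Pair m n p → Pair m n p}
    (hg : ContDiffAt ℝ k g z) : ContDiffAt ℝ k (fun w => oTangentProjLinear w (g w)) z := by
  change ContDiffAt ℝ k (fun w => oTangentProj w (g w)) z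
  unfold oTangentProj
  fun_prop

theorem contDiffAt_oGradLifted {k : ℕ} (hf : SmoothOnMp p f) (hz : z ∈ Rp m n p) :
    ContDiffAt ℝ k (oGradLifted f : Pair m n p → Pair m n p) z :=
  contDiffAt_oTangentProjLinear (contDiffAt_egrad hf hz)

theorem oGradLifted_mem_oHorizontal (hf : SmoothOnMp p f) (hz : z ∈ SRp m n p) :
    oGradLifted f z ∈ oHorizontal z := by
  refine ⟨oTangentProj_mem hz _, fun v hv => ?_⟩
  obtain ⟨W, hW, rfl⟩ := mem_oVertical.1 hv
  rw [oFrame_of_symPart_eq_zero hW]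
  exact (oMetric_oTangentProj (egrad f z) ((vert_mem_oTangent_iff hz).2 hW)).trans
    (oMetric_egrad_eq_zero_of_dproj hf (SRp_subset_Rp hz) (dproj_vert z W))

/-- The covariant derivative on `SRp m n p` of the field `Y` at `z`, as a linear map of the
direction. -/
noncomputable def oConnLinear (Y : Pair m n p → Pair m n p) (z : Pair m n p) :
    Pair m n p →ₗ[ℝ] Pair m n p :=
  oTangentProjLinear z ∘ₗ (fderiv ℝ Y z).toLinearMap

theorem contDiffAt_oConnLinear {k : ℕ} {Y : Pair m n p → Pair m n p}
    (hY : ContDiffAt ℝ (k + 1 : ℕ) Y z) (u : Pair m n p) :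
    ContDiffAt ℝ k (fun w => oConnLinear Y w u) z :=
  contDiffAt_oTangentProjLinear
    ((hY.fderiv_right (m := k) (by norm_cast)).clm_apply contDiffAt_const)

theorem isNewtonVector_ortho_iff (hf : SmoothOnMp p f) (hz : z ∈ SRp m n p) (u : Pair m n p) :
    IsNewtonVector oHorizontal oVertical oConn (oGradLifted f) z u ↔
      oDefect z u = 0 ∧ ∃ Q, oConnLinear (oGradLifted f) z u + oFrame z Q = -oGradLifted f z := by
  have hY := oGradLifted_mem_oHorizontal hf hz
  have hnegY : -oGradLifted f z ∈ oHorizontal z := by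
    rw [mem_oHorizontal, map_neg, mem_oHorizontal.1 hY, neg_zero]
  rw [IsNewtonVector, IsHorizontalProj, mem_oHorizontal (u := u), and_iff_right hnegY,
    mem_oVertical]
  refine and_congr_right fun _ => ⟨?_, ?_⟩
  · rintro ⟨W, -, hW⟩
    refine ⟨-W, ?_⟩
    rw [map_neg, hW, ← sub_eq_add_neg]
    exact sub_sub_cancel _ _
  · rintro ⟨Q, hQ⟩
    have hframe : oFrame z (-Q) = oConn (oGradLifted f) z u - -oGradLifted f z := by
      rw [map_neg, ← hQ]
      exact (sub_add_cancel_left _ _).symm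
    have hconn : oConn (oGradLifted f) z u ∈ oTangent z := oTangentProj_mem hz _
    refine ⟨-Q, symPart_eq_zero_of_oFrame_mem hz ?_, hframe⟩
    rw [hframe, mem_oTangent, Prod.fst_sub, Matrix.mul_sub, isLinearMap_symPart.map_sub,
      mem_oTangent.1 hconn, mem_oTangent.1 hnegY.1, sub_zero]

namespace IsLiftedNondegenerate

theorem oGradLifted_eq_zero (h : IsLiftedNondegenerate f z) : oGradLifted f z = 0 :=
  (congr_arg (oTangentProjLinear z) h.egrad_eq_zero).trans (map_zero _)

theorem fderiv_oGradLifted (h : IsLiftedNondegenerate f z) (hf : SmoothOnMp p f)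
    (hz : z ∈ Rp m n p) (u : Pair m n p) :
    fderiv ℝ (oGradLifted f) z u = oTangentProj z (fderiv ℝ (egrad f) z u) :=
  fderiv_linearMap_apply_of_eq_zero (P := oTangentProjLinear)
    (fun _ => contDiffAt_oTangentProjLinear contDiffAt_const)
    ((contDiffAt_egrad (k := 1) hf hz).differentiableAt (by simp)) h.egrad_eq_zero u

theorem oConnLinear_oGradLifted (h : IsLiftedNondegenerate f z) (hf : SmoothOnMp p f)
    (hz : z ∈ SRp m n p) (u : Pair m n p) :
    oConnLinear (oGradLifted f) z u = fderiv ℝ (oGradLifted f) z u := by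
  refine oTangentProj_of_mem ?_
  rw [ContinuousLinearMap.coe_coe, h.fderiv_oGradLifted hf (SRp_subset_Rp hz)]
  exact oTangentProj_mem hz _

theorem oMetric_oConnLinear (h : IsLiftedNondegenerate f z) (hf : SmoothOnMp p f)
    (hz : z ∈ SRp m n p) (u : Pair m n p) {t : Pair m n p} (ht : t ∈ oTangent z) :
    oMetric (oConnLinear (oGradLifted f) z u) t = fderiv ℝ (fderiv ℝ (lifted f)) z u t := by
  rw [h.oConnLinear_oGradLifted hf hz, h.fderiv_oGradLifted hf (SRp_subset_Rp hz),
    oMetric_oTangentProj _ ht, fderiv_egrad hf (SRp_subset_Rp hz), oMetric_riesz]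

theorem dproj_eq_zero_of_oConnLinear (h : IsLiftedNondegenerate f z) (hf : SmoothOnMp p f)
    (hz : z ∈ SRp m n p) {u : Pair m n p} (hu : oConnLinear (oGradLifted f) z u = 0) :
    dproj z u = 0 := by
  refine h.dproj_eq_zero u (ContinuousLinearMap.ext fun v => ?_)
  have ht : v - vert z (symPart (z.1ᵀ * v.1)) ∈ oTangent z := by
    rw [mem_oTangent, Prod.fst_sub, vert_apply, Matrix.mul_sub, ← Matrix.mul_assoc, hz.1,
      Matrix.one_mul, isLinearMap_symPart.map_sub, symPart_symPart, sub_self]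
  rw [← sub_add_cancel v (vert z (symPart (z.1ᵀ * v.1))), map_add,
    h.hess_eq_zero _ _ (dproj_vert _ _), ← h.oMetric_oConnLinear hf hz u ht, hu]
  simp [oMetric]

theorem isNondegenerateBordering_ortho (h : IsLiftedNondegenerate f z) (hf : SmoothOnMp p f)
    (hz : z ∈ SRp m n p) :
    IsNondegenerateBordering (oConnLinear (oGradLifted f) z) (oFrame z) (oDefect z) (dproj z) := by
  refine ⟨?_, oFrame_injective (SRp_subset_Rp hz).1, fun u hu =>
    h.dproj_eq_zero_of_oConnLinear hf hz hu, ?_⟩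
  · refine Submodule.disjoint_def.2 ?_
    rintro _ ⟨u, rfl⟩ ⟨Q, hQ⟩
    have hQ0 : symPart Q = 0 :=
      symPart_eq_zero_of_oFrame_mem hz (by rw [hQ]; exact oTangentProj_mem hz _)
    rw [oFrame_of_symPart_eq_zero hQ0] at hQ
    refine eq_zero_of_oMetric_self ?_
    nth_rw 2 [← hQ]
    rw [h.oMetric_oConnLinear hf hz u ((vert_mem_oTangent_iff hz).2 hQ0)]
    exact h.hess_eq_zero _ _ (dproj_vert z Q)
  · refine Submodule.disjoint_def.2 fun u hC hπ => ?_
    obtain ⟨R, rfl⟩ := exists_vert_eq (SRp_subset_Rp hz) hπ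
    have hor := mem_oHorizontal.2 hC
    exact eq_zero_of_oMetric_self
      (hor.2 _ (vert_mem_oVertical ((vert_mem_oTangent_iff hz).1 hor.1)))

theorem exists_isNewtonField_ortho (h : IsLiftedNondegenerate f z) (hf : SmoothOnMp p f)
    (hz : z ∈ SRp m n p) :
    ∃ x, IsNewtonField (SRp m n p) (IsNewtonVector oHorizontal oVertical oConn (oGradLifted f))
      (dproj z) z x := by
  have hzR := SRp_subset_Rp hz
  refine FixedRank.exists_isNewtonField (contDiffAt_oConnLinear (contDiffAt_oGradLifted hf hzR))
    (fun Q => ?_) (fun u => ?_) (contDiffAt_oGradLifted hf hzR) h.oGradLifted_eq_zero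
    (h.oConnLinear_oGradLifted hf hz) (h.isNondegenerateBordering_ortho hf hz) ?_
  · simp only [oFrame_apply]
    fun_prop
  · simp only [oDefect_apply, skewPart_apply]
    fun_prop
  · filter_upwards [self_mem_nhdsWithin] with w hw u using isNewtonVector_ortho_iff hf hw u

end IsLiftedNondegenerate

end Orthonormal

/-! ### The exponential map of the orthonormal factorizations -/

section BlockMatrices

variable {E : Type*} [NormedAddCommGroup E] [NormedSpace ℝ E] {k : WithTop ℕ∞} {x : E}
  {a b c d : Type*} [Fintype a] [Fintype b] [Fintype c] [Fintype d]

@[fun_prop]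
theorem contDiffAt_fromBlocks {A : E → Matrix a c ℝ} {B : E → Matrix a d ℝ}
    {C : E → Matrix b c ℝ} {D : E → Matrix b d ℝ} (hA : ContDiffAt ℝ k A x)
    (hB : ContDiffAt ℝ k B x) (hC : ContDiffAt ℝ k C x) (hD : ContDiffAt ℝ k D x) :
    ContDiffAt ℝ k (fun y => Matrix.fromBlocks (A y) (B y) (C y) (D y)) x := by
  let L : (Matrix a c ℝ × Matrix a d ℝ × Matrix b c ℝ × Matrix b d ℝ) →ₗ[ℝ]
      Matrix (a ⊕ b) (c ⊕ d) ℝ :=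
    { toFun := fun q => Matrix.fromBlocks q.1 q.2.1 q.2.2.1 q.2.2.2
      map_add' := fun q r => by simp [Matrix.fromBlocks_add]
      map_smul' := fun t q => by simp [Matrix.fromBlocks_smul] }
  exact contDiffAt_linearMap_comp L (hA.prodMk (hB.prodMk (hC.prodMk hD)))

@[fun_prop]
theorem contDiffAt_fromCols {A : E → Matrix a b ℝ} {B : E → Matrix a c ℝ}
    (hA : ContDiffAt ℝ k A x) (hB : ContDiffAt ℝ k B x) :
    ContDiffAt ℝ k (fun y => Matrix.fromCols (A y) (B y)) x := by
  let L : (Matrix a b ℝ × Matrix a c ℝ) →ₗ[ℝ] Matrix a (b ⊕ c) ℝ :=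
    { toFun := fun q => Matrix.fromCols q.1 q.2
      map_add' := fun q r => by ext i (j | j) <;> rfl
      map_smul' := fun t q => by ext i (j | j) <;> rfl }
  exact contDiffAt_linearMap_comp L (hA.prodMk hB)

attribute [local instance] Matrix.frobeniusNormedRing Matrix.frobeniusNormedAlgebra

theorem mul_matrix_exp_of_mul_eq [DecidableEq a] {D B B' : Matrix a a ℝ} (h : D * B = B' * D) :
    D * NormedSpace.exp B = NormedSpace.exp B' * D := by
  have : CompleteSpace (Matrix a a ℝ) := FiniteDimensional.complete ℝ _
  let _ : NormedAlgebra ℚ (Matrix a a ℝ) := NormedAlgebra.restrictScalars ℚ ℝ _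
  exact SemiconjBy.exp_right (show SemiconjBy D B B' from h)

end BlockMatrices

section Exponential

variable {m n p : ℕ}

/-- The matrix `[A -S; I A]` of `oExp z u`, with `A = MᵀṀ` and `S = ṀᵀṀ`. -/
def oExpGenerator (z u : Pair m n p) : Matrix (Fin p ⊕ Fin p) (Fin p ⊕ Fin p) ℝ :=
  Matrix.fromBlocks (z.1ᵀ * u.1) (-(u.1ᵀ * u.1)) 1 (z.1ᵀ * u.1)

theorem oExp_fst (z u : Pair m n p) :
    (oExp z u).1 = Matrix.fromCols z.1 u.1 * NormedSpace.exp (oExpGenerator z u)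
      * Matrix.fromRows (1 : Mat p p) (0 : Mat p p) * NormedSpace.exp (-(z.1ᵀ * u.1)) := rfl

theorem oExp_smul_fst (z u : Pair m n p) (t : ℝ) :
    (oExp z (t • u)).1 = Matrix.fromCols z.1 u.1 * NormedSpace.exp (t • oExpGenerator z u)
      * Matrix.fromRows (1 : Mat p p) (0 : Mat p p) * NormedSpace.exp (t • -(z.1ᵀ * u.1)) := by
  let D : Matrix (Fin p ⊕ Fin p) (Fin p ⊕ Fin p) ℝ := Matrix.fromBlocks 1 0 0 (t • (1 : Mat p p))
  have hcols : Matrix.fromCols z.1 (t • u.1) = Matrix.fromCols z.1 u.1 * D := by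
    simp [D, Matrix.fromCols_mul_fromBlocks]
  have hrows : D * Matrix.fromRows (1 : Mat p p) (0 : Mat p p) = Matrix.fromRows 1 0 := by
    simp [D, Matrix.fromBlocks_mul_fromRows]
  have hexp : D * NormedSpace.exp (oExpGenerator z (t • u))
      = NormedSpace.exp (t • oExpGenerator z u) * D :=
    mul_matrix_exp_of_mul_eq (by
      simp [D, oExpGenerator, Matrix.fromBlocks_multiply, Matrix.fromBlocks_smul])
  rw [oExp_fst, Prod.smul_fst, hcols, Matrix.mul_assoc _ D, hexp, ← Matrix.mul_assoc,
    Matrix.mul_assoc _ D, hrows, Matrix.mul_smul, smul_neg]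

theorem oExp_zero (z : Pair m n p) : oExp z 0 = z := by
  have hfst := oExp_smul_fst z 0 0
  rw [smul_zero] at hfst
  refine Prod.ext (hfst.trans ?_) ?_
  · simp [Matrix.fromCols_mul_fromRows]
  · simp [oExp]

theorem hasDerivAt_oExp_smul (z u : Pair m n p) :
    HasDerivAt (fun t : ℝ => oExp z (t • u)) u 0 := by
  have hfst : HasDerivAt (fun t : ℝ => (oExp z (t • u)).1) u.1 0 := by
    have hprod := hasDerivAt_matrix_mul (hasDerivAt_matrix_mul (hasDerivAt_matrix_mul
      (hasDerivAt_const (0 : ℝ) (Matrix.fromCols z.1 u.1))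
      (hasDerivAt_matrix_exp_smul_zero (oExpGenerator z u)))
      (hasDerivAt_const (0 : ℝ) (Matrix.fromRows (1 : Mat p p) (0 : Mat p p))))
      (hasDerivAt_matrix_exp_smul_zero (-(z.1ᵀ * u.1)))
    simp only [zero_smul, NormedSpace.exp_zero, Matrix.mul_one, Matrix.mul_zero,
      add_zero, zero_add, Matrix.fromCols_mul_fromRows, oExpGenerator,
      Matrix.fromCols_mul_fromBlocks, Matrix.mul_neg, neg_add_cancel_left] at hprod
    simp only [oExp_smul_fst]
    exact hprod
  have hsnd : HasDerivAt (fun t : ℝ => (oExp z (t • u)).2) u.2 0 := by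
    have hline := ((hasDerivAt_id (0 : ℝ)).smul_const u.2).const_add z.2
    rw [one_smul] at hline
    exact hline
  exact hfst.prodMk hsnd

theorem contDiffAt_oExp {k : WithTop ℕ∞} (q : Pair m n p × Pair m n p) :
    ContDiffAt ℝ k (fun q : Pair m n p × Pair m n p => oExp q.1 q.2) q := by
  unfold oExp
  fun_prop

theorem isRetractionAt_oExp (z : Pair m n p) : IsRetractionAt (oExp : Pair m n p → _ → _) z :=
  ⟨contDiffAt_oExp _, oExp_zero, hasDerivAt_oExp_smul z⟩

end Exponential

/-! ### Invariance under the general linear group -/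

theorem fderiv_apply_of_equivariant {E F : Type*} [NormedAddCommGroup E] [NormedSpace ℝ E]
    [NormedAddCommGroup F] [NormedSpace ℝ F] {Y : E → F} {L : E ≃L[ℝ] E} {L' : F ≃L[ℝ] F}
    (h : ∀ w, Y (L w) = L' (Y w)) (z u : E) :
    fderiv ℝ Y (L z) (L u) = L' (fderiv ℝ Y z u) := by
  have heq : Y ∘ L = L' ∘ Y := funext h
  have hfderiv := congrArg (fun φ : E → F => fderiv ℝ φ z u) heq
  simp only [L.comp_right_fderiv, L'.comp_fderiv] at hfderiv
  exact hfderiv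

section GeneralLinear

variable {m n p : ℕ} {f : Mat m n → ℝ} {z u v : Pair m n p}

theorem IsNewtonVector.map {H V : Pair m n p → Set (Pair m n p)}
    {conn : (Pair m n p → Pair m n p) → Pair m n p → Pair m n p → Pair m n p}
    {Y : Pair m n p → Pair m n p} (h : IsNewtonVector H V conn Y z u) {L : Type*}
    [FunLike L (Pair m n p) (Pair m n p)] [AddMonoidHomClass L (Pair m n p) (Pair m n p)] (φ : L)
    (hH : ∀ v ∈ H z, φ v ∈ H (φ z)) (hV : ∀ v ∈ V z, φ v ∈ V (φ z)) (hY : Y (φ z) = φ (Y z))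
    (hconn : conn Y (φ z) (φ u) = φ (conn Y z u)) : IsNewtonVector H V conn Y (φ z) (φ u) := by
  obtain ⟨hu, hYu, hvert⟩ := h
  rw [IsNewtonVector, IsHorizontalProj, hY, hconn, ← map_neg, ← map_sub]
  exact ⟨hH _ hu, hH _ hYu, hV _ hvert⟩

theorem act_inv_act (R : (Mat p p)ˣ) (z : Pair m n p) : act R⁻¹ (act R z) = z :=
  (act R).symm_apply_apply z

theorem act_act_inv (R : (Mat p p)ˣ) (z : Pair m n p) : act R (act R⁻¹ z) = z :=
  (act R).apply_symm_apply z

theorem trace_mul_transpose_mul {a : ℕ} (A B : Mat a p) (P : Mat p p) :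
    ((A * P)ᵀ * B).trace = (Aᵀ * (B * Pᵀ)).trace := by
  rw [Matrix.transpose_mul, Matrix.mul_assoc, Matrix.trace_mul_comm, Matrix.mul_assoc]

theorem fderiv_lifted_act (f : Mat m n → ℝ) (R : (Mat p p)ˣ) (z v : Pair m n p) :
    fderiv ℝ (lifted f) (act R z) (act R v) = fderiv ℝ (lifted f) z v :=
  fderiv_apply_of_equivariant (Y := lifted f) (L := act R) (L' := .refl ℝ ℝ)
    (fun w => congrArg f (proj_act R w)) z v

theorem egrad_act (f : Mat m n → ℝ) (R : (Mat p p)ˣ) (z : Pair m n p) :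
    egrad f (act R z) = ((egrad f z).1 * (↑R⁻¹ : Mat p p)ᵀ, (egrad f z).2 * (R : Mat p p)) := by
  refine oMetric_ext fun v => ?_
  obtain ⟨v, rfl⟩ := (act R).surjective v
  rw [egrad, oMetric_riesz, fderiv_lifted_act, ← oMetric_riesz, ← egrad]
  simp only [oMetric, Matrix.trace_add, trace_mul_transpose_mul, act_fst, act_snd,
    Matrix.transpose_transpose, Matrix.mul_assoc, ← Matrix.transpose_mul, Units.mul_inv,
    Matrix.transpose_one, Matrix.mul_one]

theorem transpose_mul_mul {a : ℕ} (x y : Mat a p) (P : Mat p p) :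
    (x * P)ᵀ * (y * P) = Pᵀ * (xᵀ * y) * P := by
  simp only [Matrix.transpose_mul, Matrix.mul_assoc]

theorem symPart_conj (P A : Mat p p) : symPart (Pᵀ * A * P) = Pᵀ * symPart A * P := by
  simp only [symPart, Matrix.transpose_mul, Matrix.transpose_transpose, Matrix.mul_smul,
    Matrix.smul_mul, Matrix.mul_add, Matrix.add_mul, Matrix.mul_assoc]

theorem mul_gram_inv_mul_conj {a b : ℕ} {P : Mat p p} (hP : IsUnit P.det) (M : Mat a p)
    (A : Mat b p) (S : Mat p p) :
    A * P * ((M * P)ᵀ * (M * P))⁻¹ * (Pᵀ * S * P) = A * (Mᵀ * M)⁻¹ * S * P := by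
  have hPt := Matrix.isUnit_det_transpose P hP
  calc A * P * ((M * P)ᵀ * (M * P))⁻¹ * (Pᵀ * S * P)
      = A * (P * P⁻¹) * (Mᵀ * M)⁻¹ * (Pᵀ⁻¹ * Pᵀ) * S * P := by
        rw [transpose_mul_mul, Matrix.mul_inv_rev, Matrix.mul_inv_rev]
        simp only [Matrix.mul_assoc]
    _ = A * (Mᵀ * M)⁻¹ * S * P := by
        rw [Matrix.mul_nonsing_inv _ hP, Matrix.nonsing_inv_mul _ hPt, Matrix.mul_one,
          Matrix.mul_one]

theorem connFactor_mul {a : ℕ} {P : Mat p p} (hP : IsUnit P.det) (M x y dy : Mat a p) :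
    connFactor (M * P) (x * P) (y * P) (dy * P) = connFactor M x y dy * P := by
  have hsym : ∀ A B : Mat a p, symPart ((A * P)ᵀ * (B * P)) = Pᵀ * symPart (Aᵀ * B) * P :=
    fun A B => by rw [transpose_mul_mul, symPart_conj]
  simp only [connFactor, hsym, mul_gram_inv_mul_conj hP, Matrix.sub_mul, Matrix.add_mul]

theorem trace_gram_inv_mul_conj {a : ℕ} {P : Mat p p} (hP : IsUnit P.det) (M x y : Mat a p) :
    (((M * P)ᵀ * (M * P))⁻¹ * (x * P)ᵀ * (y * P)).trace = ((Mᵀ * M)⁻¹ * xᵀ * y).trace := by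
  have hconj := mul_gram_inv_mul_conj hP M P⁻¹ (xᵀ * y)
  rw [Matrix.nonsing_inv_mul _ hP, Matrix.one_mul] at hconj
  rw [Matrix.mul_assoc, transpose_mul_mul x, hconj, Matrix.trace_mul_comm]
  simp only [Matrix.mul_assoc, Matrix.mul_nonsing_inv_cancel_left _ _ hP]

theorem isUnit_det_transpose_inv (R : (Mat p p)ˣ) : IsUnit (↑R⁻¹ : Mat p p)ᵀ.det :=
  Matrix.isUnit_det_transpose _ (Matrix.isUnits_det_units R⁻¹)

theorem metric_act (R : (Mat p p)ˣ) (z u v : Pair m n p) :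
    metric (act R z) (act R u) (act R v) = metric z u v := by
  simp only [metric, act_fst, act_snd, Matrix.trace_add,
    trace_gram_inv_mul_conj (Matrix.isUnits_det_units R),
    trace_gram_inv_mul_conj (isUnit_det_transpose_inv R)]

theorem act_vert (R : (Mat p p)ˣ) (z : Pair m n p) (Q : Mat p p) :
    act R (vert z Q) = vert (act R z) (↑R⁻¹ * Q * R) := by
  refine Prod.ext ?_ ?_
  · simp only [vert_apply, act_fst, Matrix.mul_assoc, Units.mul_inv_cancel_left]
  · have hinv : (↑R⁻¹ : Mat p p)ᵀ * (R : Mat p p)ᵀ = 1 := by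
      rw [← Matrix.transpose_mul, Units.mul_inv, Matrix.transpose_one]
    simp only [vert_apply, act_snd, Matrix.neg_mul, Matrix.transpose_mul]
    rw [Matrix.mul_assoc z.2 Qᵀ, ← Matrix.mul_assoc (z.2 * _),
      Matrix.mul_assoc z.2 _ (R : Mat p p)ᵀ, hinv, Matrix.mul_one]

theorem act_mem_vertical (R : (Mat p p)ˣ) (hv : v ∈ vertical z) :
    act R v ∈ vertical (act R z) := by
  obtain ⟨Q, rfl⟩ := hv
  exact ⟨_, act_vert R z Q⟩

theorem act_mem_horizontal (R : (Mat p p)ˣ) (hu : u ∈ horizontal z) :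
    act R u ∈ horizontal (act R z) := fun v hv => by
  have hv' := act_mem_vertical R⁻¹ hv
  rw [act_inv_act] at hv'
  rw [← act_act_inv R v, metric_act]
  exact hu _ hv'

theorem gradLifted_act (f : Mat m n → ℝ) (R : (Mat p p)ˣ) (z : Pair m n p) :
    gradLifted f (act R z) = act R (gradLifted f z) := by
  change gramMul (act R z) (egrad f (act R z)) = act R (gramMul z (egrad f z))
  have hinv : (↑R⁻¹ : Mat p p)ᵀ * (R : Mat p p)ᵀ = 1 := by
    rw [← Matrix.transpose_mul, Units.mul_inv, Matrix.transpose_one]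
  rw [egrad_act]
  refine Prod.ext ?_ ?_
  · simp only [gramMul, LinearMap.coe_mk, AddHom.coe_mk, act_fst, transpose_mul_mul]
    rw [← Matrix.mul_assoc, ← Matrix.mul_assoc, Matrix.mul_assoc _ _ (R : Mat p p)ᵀ, hinv,
      Matrix.mul_one]
  · simp only [gramMul, LinearMap.coe_mk, AddHom.coe_mk, act_snd, transpose_mul_mul,
      Matrix.transpose_transpose]
    rw [← Matrix.mul_assoc, ← Matrix.mul_assoc, Matrix.mul_assoc _ (R : Mat p p), Units.mul_inv,
      Matrix.mul_one]

theorem conn_gradLifted_act (f : Mat m n → ℝ) (R : (Mat p p)ˣ) (z u : Pair m n p) :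
    conn (gradLifted f) (act R z) (act R u) = act R (conn (gradLifted f) z u) := by
  have hfderiv : fderiv ℝ (gradLifted f) (act R z) (act R u)
      = act R (fderiv ℝ (gradLifted f) z u) :=
    fderiv_apply_of_equivariant (gradLifted_act f R) z u
  rw [conn, hfderiv, gradLifted_act]
  exact Prod.ext (connFactor_mul (Matrix.isUnits_det_units R) _ _ _ _)
    (connFactor_mul (isUnit_det_transpose_inv R) _ _ _ _)

theorem isNewtonVector_act (R : (Mat p p)ˣ)
    (h : IsNewtonVector horizontal vertical conn (gradLifted f) z u) :
    IsNewtonVector horizontal vertical conn (gradLifted f) (act R z) (act R u) :=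
  h.map (act R) (fun _ => act_mem_horizontal R) (fun _ => act_mem_vertical R)
    (gradLifted_act f R z) (conn_gradLifted_act f R z u)

end GeneralLinear

/-! ### Invariance under the orthogonal group -/

section Orthogonal

variable {m n p : ℕ} {f : Mat m n → ℝ} {z u v : Pair m n p} {R : (Mat p p)ˣ}

theorem orthogonal_of_act_mem (hz : z ∈ SRp m n p) (hz' : act R z ∈ SRp m n p) :
    (R : Mat p p)ᵀ * R = 1 := by
  have h := hz'.1
  rwa [act_fst, transpose_mul_mul, hz.1, Matrix.mul_one] at h

theorem coe_inv_of_orthogonal (hR : (R : Mat p p)ᵀ * R = 1) : (↑R⁻¹ : Mat p p) = (R : Mat p p)ᵀ :=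
  Units.inv_eq_of_mul_eq_one_left hR

theorem orthogonal_inv (hR : (R : Mat p p)ᵀ * R = 1) :
    (↑R⁻¹ : Mat p p)ᵀ * (↑R⁻¹ : Mat p p) = 1 := by
  rw [coe_inv_of_orthogonal hR, Matrix.transpose_transpose, mul_eq_one_comm.1 hR]

theorem act_of_orthogonal (hR : (R : Mat p p)ᵀ * R = 1) (z : Pair m n p) :
    act R z = (z.1 * (R : Mat p p), z.2 * (R : Mat p p)) :=
  Prod.ext rfl (by rw [act_snd, coe_inv_of_orthogonal hR, Matrix.transpose_transpose])

theorem mul_mul_conj_of_orthogonal {a : ℕ} {P : Mat p p} (hP : Pᵀ * P = 1) (A : Mat a p)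
    (W : Mat p p) : A * P * (Pᵀ * W * P) = A * W * P := by
  calc A * P * (Pᵀ * W * P) = A * (P * Pᵀ) * W * P := by simp only [Matrix.mul_assoc]
    _ = A * W * P := by rw [mul_eq_one_comm.1 hP, Matrix.mul_one]

theorem oMetric_act (hR : (R : Mat p p)ᵀ * R = 1) (u v : Pair m n p) :
    oMetric (act R u) (act R v) = oMetric u v := by
  simp only [oMetric, act_of_orthogonal hR, Matrix.trace_add, trace_mul_transpose_mul,
    Matrix.mul_assoc, mul_eq_one_comm.1 hR, Matrix.mul_one]

theorem oTangentProj_act (hR : (R : Mat p p)ᵀ * R = 1) (z w : Pair m n p) :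
    oTangentProj (act R z) (act R w) = act R (oTangentProj z w) := by
  refine Prod.ext ?_ rfl
  simp only [oTangentProj, act_fst, transpose_mul_mul, symPart_conj, Matrix.sub_mul,
    mul_mul_conj_of_orthogonal hR]

theorem act_mem_oVertical (hR : (R : Mat p p)ᵀ * R = 1) (hv : v ∈ oVertical z) :
    act R v ∈ oVertical (act R z) := by
  obtain ⟨W, hW, rfl⟩ := hv
  refine ⟨(R : Mat p p)ᵀ * W * R, ?_, ?_⟩
  · rw [← symPart_eq_zero_iff] at hW ⊢
    rw [symPart_conj, hW, Matrix.mul_zero, Matrix.zero_mul]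
  · simp only [act_of_orthogonal hR, mul_mul_conj_of_orthogonal hR]

theorem act_mem_oTangent (R : (Mat p p)ˣ) (hu : u ∈ oTangent z) :
    act R u ∈ oTangent (act R z) := by
  rw [mem_oTangent] at hu ⊢
  rw [act_fst, act_fst, transpose_mul_mul, symPart_conj, hu, Matrix.mul_zero, Matrix.zero_mul]

theorem act_mem_oHorizontal (hR : (R : Mat p p)ᵀ * R = 1) (hu : u ∈ oHorizontal z) :
    act R u ∈ oHorizontal (act R z) := by
  refine ⟨act_mem_oTangent R hu.1, fun v hv => ?_⟩
  have hv' := act_mem_oVertical (orthogonal_inv hR) hv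
  rw [act_inv_act] at hv'
  rw [← act_act_inv R v, oMetric_act hR]
  exact hu.2 _ hv'

theorem oGradLifted_act (f : Mat m n → ℝ) (hR : (R : Mat p p)ᵀ * R = 1) (z : Pair m n p) :
    oGradLifted f (act R z) = act R (oGradLifted f z) := by
  have hegrad : egrad f (act R z) = act R (egrad f z) := by
    rw [egrad_act, act_of_orthogonal hR, coe_inv_of_orthogonal hR, Matrix.transpose_transpose]
  change oTangentProj (act R z) (egrad f (act R z)) = act R (oTangentProj z (egrad f z))
  rw [hegrad, oTangentProj_act hR]

theorem oConn_oGradLifted_act (f : Mat m n → ℝ) (hR : (R : Mat p p)ᵀ * R = 1)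
    (z u : Pair m n p) :
    oConn (oGradLifted f) (act R z) (act R u) = act R (oConn (oGradLifted f) z u) := by
  have hfderiv : fderiv ℝ (oGradLifted f) (act R z) (act R u)
      = act R (fderiv ℝ (oGradLifted f) z u) :=
    fderiv_apply_of_equivariant (oGradLifted_act f hR) z u
  rw [oConn, hfderiv, oTangentProj_act hR, oConn]

theorem isNewtonVector_ortho_act (hR : (R : Mat p p)ᵀ * R = 1)
    (h : IsNewtonVector oHorizontal oVertical oConn (oGradLifted f) z u) :
    IsNewtonVector oHorizontal oVertical oConn (oGradLifted f) (act R z) (act R u) :=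
  h.map (act R) (fun _ => act_mem_oHorizontal hR) (fun _ => act_mem_oVertical hR)
    (oGradLifted_act f hR z) (oConn_oGradLifted_act f hR z u)

theorem fromBlocks_mul_oExpGenerator_act (hR : (R : Mat p p)ᵀ * R = 1) (z u : Pair m n p) :
    Matrix.fromBlocks (R : Mat p p) 0 0 R * oExpGenerator (act R z) (act R u)
      = oExpGenerator z u * Matrix.fromBlocks (R : Mat p p) 0 0 R := by
  have hconj : ∀ A : Mat p p, (R : Mat p p) * ((R : Mat p p)ᵀ * A * R) = A * R := fun A => by
    simpa only [Matrix.one_mul] using mul_mul_conj_of_orthogonal hR (1 : Mat p p) A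
  simp only [oExpGenerator, act_fst, transpose_mul_mul, Matrix.fromBlocks_multiply, hconj,
    Matrix.zero_mul, Matrix.mul_zero, add_zero, zero_add, neg_zero, Matrix.mul_neg, Matrix.neg_mul,
    Matrix.mul_one, Matrix.one_mul]

theorem oExp_act (hR : (R : Mat p p)ᵀ * R = 1) (z u : Pair m n p) :
    oExp (act R z) (act R u) = act R (oExp z u) := by
  refine Prod.ext ?_ (Matrix.add_mul _ _ _).symm
  let D : Matrix (Fin p ⊕ Fin p) (Fin p ⊕ Fin p) ℝ := Matrix.fromBlocks (R : Mat p p) 0 0 R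
  have hcols : Matrix.fromCols (act R z).1 (act R u).1 = Matrix.fromCols z.1 u.1 * D := by
    simp [D, act_fst, Matrix.fromCols_mul_fromBlocks]
  have hrows : D * Matrix.fromRows (1 : Mat p p) (0 : Mat p p)
      = Matrix.fromRows (1 : Mat p p) (0 : Mat p p) * (R : Mat p p) := by
    simp [D, Matrix.fromBlocks_mul_fromRows, Matrix.fromRows_mul]
  have hgen := mul_matrix_exp_of_mul_eq (fromBlocks_mul_oExpGenerator_act hR z u)
  have hneg : (R : Mat p p) * NormedSpace.exp (-((act R z).1ᵀ * (act R u).1))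
      = NormedSpace.exp (-(z.1ᵀ * u.1)) * (R : Mat p p) := mul_matrix_exp_of_mul_eq (by
    rw [act_fst, act_fst, transpose_mul_mul, Matrix.mul_neg, Matrix.neg_mul, Matrix.mul_assoc,
      ← Matrix.mul_assoc (R : Mat p p), mul_eq_one_comm.1 hR, Matrix.one_mul])
  rw [act_fst, oExp_fst, oExp_fst, hcols, Matrix.mul_assoc _ D, hgen, ← Matrix.mul_assoc,
    Matrix.mul_assoc _ D, hrows, ← Matrix.mul_assoc, Matrix.mul_assoc _ (R : Mat p p), hneg,
    ← Matrix.mul_assoc]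

end Orthogonal

/-! ### Quadratic convergence -/

section Convergence

variable {m n p : ℕ} {f : Mat m n → ℝ} {z u : Pair m n p} {T : Set (Pair m n p)}
  {newton : Pair m n p → Pair m n p → Prop} {e : Pair m n p → Pair m n p → Pair m n p}

theorem isStep_proj (hT : T ⊆ Rp m n p)
    (hnewton : ∀ w ∈ T, ∀ R, act R w ∈ T → ∀ v, newton w v → newton (act R w) (act R v))
    (he : ∀ w ∈ T, ∀ R, act R w ∈ T → ∀ v, e (act R w) (act R v) = act R (e w v))
    (hz : z ∈ T) (hu : ∀ v, newton z v ↔ v = u) (hmem : e z u ∈ Rp m n p) :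
    IsStep T newton (fun w v => proj (e w v)) (proj z) (proj (e z u)) := by
  refine ⟨⟨z, hz, rfl⟩, proj_mem hmem, fun w hw hproj => ?_⟩
  obtain ⟨R, rfl⟩ := exists_act_eq (hT hz) (hT hw) hproj.symm
  refine ⟨act R u, hnewton z hz R hw u ((hu u).2 rfl), fun v hv => ?_, ?_⟩
  · have hv' := hnewton _ hw R⁻¹ (by rwa [act_inv_act]) v hv
    rw [act_inv_act] at hv'
    rw [← (hu _).1 hv', act_act_inv]
  · exact (congrArg proj (he z hz R hw u)).trans (proj_act R _)

theorem IsNewtonField.locallyQuadraticallyConvergent {x : Pair m n p → Pair m n p}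
    (hx : IsNewtonField T newton (dproj z) z x) (he : IsRetractionAt e z) (hST : SRp m n p ⊆ T)
    (hT : T ⊆ Rp m n p) (hz : z ∈ SRp m n p)
    (hnewton : ∀ w ∈ T, ∀ R, act R w ∈ T → ∀ v, newton w v → newton (act R w) (act R v))
    (he_act : ∀ w ∈ T, ∀ R, act R w ∈ T → ∀ v, e (act R w) (act R v) = act R (e w v)) :
    LocallyQuadraticallyConvergent p (IsStep T newton fun w v => proj (e w v)) (proj z) := by
  obtain ⟨σ, hσ, hσ_mem⟩ := exists_isBigO_section hz
  have hσ_tendsto : Tendsto σ (𝓝 (proj z)) (𝓝 z) :=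
    tendsto_sub_nhds_zero_iff.1 (hσ.trans_tendsto (tendsto_sub_nhds_zero_iff.2 tendsto_id))
  have hσ_within : Tendsto σ (𝓝[Mp m n p] proj z) (𝓝[T] z) :=
    tendsto_nhdsWithin_iff.2 ⟨hσ_tendsto.mono_left nhdsWithin_le_nhds,
      hσ_mem.mono fun _ h => hST h.1⟩
  have hmem : ∀ᶠ w in 𝓝 z, e w (x w) ∈ Rp m n p :=
    (hx.contDiffAt_retraction he).continuousAt.eventually_mem
      (isOpen_Rp.mem_nhds (by rw [hx.retraction_apply_self he]; exact SRp_subset_Rp hz))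
  have hquad : (fun w => proj (e w (x w)) - proj z) =O[𝓝 z] fun w => ‖w - z‖ ^ 2 :=
    hx.isBigO_sq he (contDiffAt_proj z) (DFunLike.congr_fun (hasFDerivAt_proj z).fderiv)
  obtain ⟨C, hC⟩ := ((hquad.comp_tendsto hσ_tendsto).trans (hσ.norm_norm.pow 2)).bound
  refine locallyQuadraticallyConvergent_of_eventually (C := C) ?_
  filter_upwards [hσ_mem, hσ_within.eventually hx.newton_iff, nhdsWithin_le_nhds hC,
    nhdsWithin_le_nhds (hσ_tendsto.eventually hmem)] with X ⟨hσX, hproj⟩ hiff hCX hR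
  refine ⟨_, proj_mem hR, ?_, by simpa using hCX⟩
  have hstep := isStep_proj hT hnewton he_act (hST hσX) hiff hR
  rwa [hproj] at hstep

theorem IsLiftedNondegenerate.locallyQuadraticallyConvergent (h : IsLiftedNondegenerate f z)
    (hf : SmoothOnMp p f) (hz : z ∈ SRp m n p) :
    LocallyQuadraticallyConvergent p (NewtonStep p f) (proj z) := by
  obtain ⟨x, hx⟩ := h.exists_isNewtonField hf (SRp_subset_Rp hz)
  exact hx.locallyQuadraticallyConvergent (isRetractionAt_add z) SRp_subset_Rp subset_rfl hz
    (fun _ _ R _ _ => isNewtonVector_act R) fun w _ R _ v => (map_add (act R) w v).symm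

theorem IsLiftedNondegenerate.locallyQuadraticallyConvergent_ortho
    (h : IsLiftedNondegenerate f z) (hf : SmoothOnMp p f) (hz : z ∈ SRp m n p) :
    LocallyQuadraticallyConvergent p (NewtonStepOrtho p f) (proj z) := by
  obtain ⟨x, hx⟩ := h.exists_isNewtonField_ortho hf hz
  exact hx.locallyQuadraticallyConvergent (isRetractionAt_oExp z) subset_rfl SRp_subset_Rp hz
    (fun _ hw _ hRw _ => isNewtonVector_ortho_act (orthogonal_of_act_mem hw hRw))
    fun _ hw _ hRw _ => oExp_act (orthogonal_of_act_mem hw hRw) _ _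

end Convergence

end FixedRank

theorem mainTheorem2 (m n p : ℕ) (hp : 0 < p) (hpm : p ≤ m) (hpn : p ≤ n)
    (f : FixedRank.Mat m n → ℝ) (hf : FixedRank.SmoothOnMp p f)
    (g : FixedRank.Mat m n → FixedRank.Mat m n → FixedRank.Mat m n → ℝ)
    (hg : FixedRank.IsRiemannianMetric p g)
    (Xs : FixedRank.Mat m n) (hXs : FixedRank.IsNondegenerateCriticalPoint p g f Xs) :
    FixedRank.LocallyQuadraticallyConvergent p (FixedRank.NewtonStep p f) Xs ∧
      FixedRank.LocallyQuadraticallyConvergent p (FixedRank.NewtonStepOrtho p f) Xs := by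
  obtain ⟨z, hz, rfl⟩ := FixedRank.exists_mem_SRp hXs.1
  have h := hXs.isLiftedNondegenerate hf hg (FixedRank.SRp_subset_Rp hz)
  exact ⟨h.locallyQuadraticallyConvergent hf hz, h.locallyQuadraticallyConvergent_ortho hf hz⟩
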